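/- \textbf{Theorem (perturbed Hamiltonian Noether theorem).} Let $M\subset X\times U=\mathbb{R}^p\times\mathbb{R}^q$ be a fixed connected open set of independent and dependent variables $(x,u)$, let $t$ range over an open interval, let $\varepsilon$ be a small parameter, $|\varepsilon|<\varepsilon_0$, and fix an order of precision $k\ge 0$. A \emph{differential function} is a smooth function $F(x,t,u^{(n)},\varepsilon)$ of $x$, $t$, $\varepsilon$ and finitely many $x$-derivatives $u^\alpha_J$ of $u$, with $(x,u)\in M$; $D_i$ are the total $x$-derivatives, $D_J$ their iterates, $\mathbf{Div}\,X=\sum_i D_iX_i$, $\mathbf{E}_\alpha=\sum_J(-D)_J\,\partial/\partial u^\alpha_J$ is the Euler operator, and $\mathbf{pr\,v}_Q=\sum_{\alpha,J}D_JQ_\alpha\,\partial/\partial u^\alpha_J$ is the prolonged evolutionary vector field with characteristic $Q$. We write $F\approx G$ if $F-G=o(\varepsilon^k)$ as $\varepsilon\to 0$ for all values of the other variables. Functionals $\mathscr{P}=\int P\,dx$ are represented by differential functions $P$, with $\int P\,dx\approx\int L\,dx$ if $P-L\approx\mathbf{Div}\,X$ for some $p$-tuple $X$ of differential functions, and $\delta\mathscr{P}=\mathbf{E}(P)$.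 Let $\mathscr{D}=\big(\sum_J \mathscr{D}_{\alpha\beta,J}[u,\varepsilon]\,D_J\big)$ be a $q\times q$ matrix of differential operators of finite order whose coefficients are differential functions not depending explicitly on $t$, and let $\mathscr{D}$ be approximately Hamiltonian: the bracket $\{\mathscr{P},\mathscr{L}\}=\int\delta\mathscr{P}\cdot\mathscr{D}\delta\mathscr{L}\,dx$ on functionals is skew-symmetric and satisfies the Jacobi identity up to $\approx$. Let $\mathscr{H}=\int H[u,\varepsilon]\,dx$ be a functional whose density does not depend explicitly on $t$, let $K=\mathscr{D}\delta\mathscr{H}$, and consider the perturbed Hamiltonian system $u_t=K$. On its solutions the total time derivative is $D_tF=\partial_tF+\mathbf{pr\,v}_K(F)$. An evolutionary vector field $\mathbf{v}_Q$ is (the infinitesimal generator of) an \emph{approximate generalized symmetry group} of the system if $D_tQ_\nu\approx\mathbf{pr\,v}_Q(K_\nu)$ for $\nu=1,\dots,q$. A functional $\int T\,dx$ is an \emph{approximate conservation law} if $D_tT+\mathbf{Div}\,X\approx 0$ for some $p$-tuple $X$ of differential functions. A functional $\mathscr{G}[t;u,\varepsilon]$, possibly depending on $t$, is an \emph{approximate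 distinguished functional} for $\mathscr{D}$ if $\mathscr{D}\delta\mathscr{G}\approx 0$. Then for every functional $\mathscr{P}=\int P(x,t,u^{(n)},\varepsilon)\,dx$, the Hamiltonian vector field $\hat{\mathbf{v}}_{\mathscr{P}}$ with characteristic $\mathscr{D}\delta\mathscr{P}$ determines an approximate generalized symmetry group of $u_t=\mathscr{D}\delta\mathscr{H}$ if and only if there are a (time-dependent) approximate distinguished functional $\mathscr{G}[t;u,\varepsilon]$ and a functional $\tilde{\mathscr{P}}\approx\mathscr{P}-\mathscr{G}$ such that $\tilde{\mathscr{P}}$ determines an approximate conservation law of the system. -/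

import Mathlib

open scoped ContDiff Topology

noncomputable section

namespace PerturbedHamiltonian

/-- Multi-indices in `p` spatial directions; `J i` counts the derivatives in direction `i`. -/
abbrev MultiIndex (p : ℕ) : Type := Fin p → ℕ

/-- The coordinates of the infinite jet space with parameters: the time `t`, the independent
variables `x^i`, the (spatial) jet variables `u^α_J`, and the perturbation parameter `ε`. -/
inductive Coord (p q : ℕ) : Type
  | time : Coord p q
  | space (i : Fin p) : Coord p q
  | jet (α : Fin q) (J : MultiIndex p) : Coord p q
  | eps : Coord p q
  deriving DecidableEq

/-- Points `(t, x, u^{(∞)}, ε)`. -/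
abbrev JetPoint (p q : ℕ) : Type := Coord p q → ℝ

/-- Real functions of `(t, x, u^{(∞)}, ε)`. -/
abbrev JetFun (p q : ℕ) : Type := JetPoint p q → ℝ

/-- The fixed domain: a connected open set `M ⊆ X × U` of the variables `(x, u)`, an open time
interval and a range `|ε| < ε₀` of the small parameter. The derivative coordinates are free. -/
structure Domain (p q : ℕ) where
  M : Set ((Fin p → ℝ) × (Fin q → ℝ))
  isOpen_M : IsOpen M
  isConnected_M : IsConnected M
  T : Set ℝ
  isOpen_T : IsOpen T
  isConnected_T : IsConnected T
  eps0 : ℝ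
  eps0_pos : 0 < eps0

/-- The part of the jet space that lies over the domain. -/
def Domain.carrier {p q : ℕ} (Ω : Domain p q) : Set (JetPoint p q) :=
  {z | z .time ∈ Ω.T ∧
    ((fun i => z (.space i), fun α => z (.jet α 0)) : (Fin p → ℝ) × (Fin q → ℝ)) ∈ Ω.M ∧
    |z .eps| < Ω.eps0}

/-- `F` is a differential function over the domain: it depends on finitely many of
the coordinates, and smoothly on these. (Projections are open maps, so the image is open.) -/
def IsDiffFun {p q : ℕ} (Ω : Domain p q) (F : JetFun p q) : Prop :=
  ∃ (S : Finset (Coord p q)) (f : (S → ℝ) → ℝ),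
    ContDiffOn ℝ ∞ f ((fun (z : JetPoint p q) (c : S) => z c) '' Ω.carrier) ∧
    ∀ z ∈ Ω.carrier, F z = f (fun c : S => z c)

/-- `F` does not depend explicitly on the time `t`. -/
def IsAutonomous {p q : ℕ} (Ω : Domain p q) (F : JetFun p q) : Prop :=
  ∀ z ∈ Ω.carrier, ∀ t ∈ Ω.T, F (Function.update z .time t) = F z

/-- `F = o(ε^k)` as `ε → 0`, for all values of the other variables. -/
def IsLittleO {p q : ℕ} (Ω : Domain p q) (k : ℕ) (F : JetFun p q) : Prop :=
  ∀ z ∈ Ω.carrier, (fun ε : ℝ => F (Function.update z .eps ε)) =o[𝓝 0] (fun ε : ℝ => ε ^ k)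

/-- The partial derivative `∂F/∂c` with respect to the coordinate `c`. -/
def pd {p q : ℕ} (c : Coord p q) (F : JetFun p q) : JetFun p q :=
  fun z => deriv (fun s : ℝ => F (Function.update z c s)) (z c)

/-- The total derivative `D_i F = ∂F/∂x^i + ∑_{α,J} u^α_{J,i} ∂F/∂u^α_J`. -/
def totalD {p q : ℕ} (i : Fin p) (F : JetFun p q) : JetFun p q :=
  fun z => pd (.space i) F z +
    ∑ α : Fin q, ∑ᶠ J : MultiIndex p, z (.jet α (J + Pi.single i 1)) * pd (.jet α J) F z

/-- The iterated total derivative `D_J = D_1^{J_1} ⋯ D_p^{J_p}`. -/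
def totalDJ {p q : ℕ} (J : MultiIndex p) (F : JetFun p q) : JetFun p q :=
  (List.finRange p).foldr (fun i G => (totalD i)^[J i] G) F

/-- The total (spatial) divergence `Div X = ∑_i D_i X_i`. -/
def totalDiv {p q : ℕ} (X : Fin p → JetFun p q) : JetFun p q :=
  fun z => ∑ i, totalD i (X i) z

/-- The prolonged evolutionary vector field with characteristic `Q` applied to `F`:
`pr v_Q (F) = ∑_{α,J} (D_J Q_α) ∂F/∂u^α_J`. -/
def prEvol {p q : ℕ} (Q : Fin q → JetFun p q) (F : JetFun p q) : JetFun p q :=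
  fun z => ∑ α : Fin q, ∑ᶠ J : MultiIndex p, totalDJ J (Q α) z * pd (.jet α J) F z

/-- The total time derivative `D_t F = ∂F/∂t + ∑_{α,J} u^α_{J,t} ∂F/∂u^α_J` on the solutions of
the evolution system `u_t = K`, that is, with `u^α_{J,t} = D_J K_α` substituted. -/
def totalDt {p q : ℕ} (K : Fin q → JetFun p q) (F : JetFun p q) : JetFun p q :=
  fun z => pd .time F z +
    ∑ α : Fin q, ∑ᶠ J : MultiIndex p, totalDJ J (K α) z * pd (.jet α J) F z

/-- The Euler operator, i.e. the variational derivative of the functional `∫ F dx`: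
`(δ ∫ F dx)_α = E_α(F) = ∑_J (-D)_J ∂F/∂u^α_J`. -/
def euler {p q : ℕ} (F : JetFun p q) : Fin q → JetFun p q :=
  fun α z => ∑ᶠ J : MultiIndex p, (-1 : ℝ) ^ (∑ i, J i) * totalDJ J (pd (.jet α J) F) z

/-- The coefficients of a `q × q` matrix of differential operators: the entry `(α, β)` is
`∑_J 𝒟_{αβ,J} D_J`, a finite sum. -/
abbrev MatDiffOp (p q : ℕ) : Type := Fin q → Fin q → (MultiIndex p →₀ JetFun p q)

/-- The action of a matrix differential operator on a `q`-tuple of differential functions. -/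
def MatDiffOp.apply {p q : ℕ} (𝒟 : MatDiffOp p q) (Q : Fin q → JetFun p q) :
    Fin q → JetFun p q :=
  fun α z => ∑ β : Fin q, (𝒟 α β).sum fun J c => c z * totalDJ J (Q β) z

/-- The coefficients are differential functions of `(x, u^{(n)}, ε)`, without explicit `t`. -/
def IsMatDiffOp {p q : ℕ} (Ω : Domain p q) (𝒟 : MatDiffOp p q) : Prop :=
  ∀ α β J, IsDiffFun Ω (𝒟 α β J) ∧ IsAutonomous Ω (𝒟 α β J)

/-- `∫ F dx = ∫ G dx + o(ε^k)`: functionals are represented by their densities, which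
are determined up to total divergences. -/
def FunctionalApprox {p q : ℕ} (Ω : Domain p q) (k : ℕ) (F G : JetFun p q) : Prop :=
  ∃ X : Fin p → JetFun p q, (∀ i, IsDiffFun Ω (X i)) ∧
    IsLittleO Ω k (fun z => F z - G z - totalDiv X z)

/-- The density of the bracket `{∫ P dx, ∫ L dx} = ∫ δP · 𝒟 δL dx`. -/
def bracket {p q : ℕ} (𝒟 : MatDiffOp p q) (P L : JetFun p q) : JetFun p q :=
  fun z => ∑ α : Fin q, euler P α z * 𝒟.apply (euler L) α z

/-- `𝒟` is an approximate Hamiltonian operator: on the space of functionals, its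
bracket is skew-symmetric and satisfies the Jacobi identity, up to `o(ε^k)`. -/
structure IsApproxHamiltonianOp {p q : ℕ} (Ω : Domain p q) (k : ℕ) (𝒟 : MatDiffOp p q) :
    Prop where
  isMatDiffOp : IsMatDiffOp Ω 𝒟
  skew : ∀ P L : JetFun p q, IsDiffFun Ω P → IsDiffFun Ω L →
    FunctionalApprox Ω k (bracket 𝒟 P L) (fun z => -bracket 𝒟 L P z)
  jacobi : ∀ P L R : JetFun p q, IsDiffFun Ω P → IsDiffFun Ω L → IsDiffFun Ω R →
    FunctionalApprox Ω k
      (fun z => bracket 𝒟 (bracket 𝒟 P L) R z + bracket 𝒟 (bracket 𝒟 L R) P z +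
        bracket 𝒟 (bracket 𝒟 R P) L z)
      (fun _ => 0)

/-- The evolutionary vector field with characteristic `Q` is an approximate generalized
symmetry of `u_t = K`: `D_t Q_ν = pr v_Q (K_ν) + o(ε^k)` on solutions. -/
def IsApproxSymmetry {p q : ℕ} (Ω : Domain p q) (k : ℕ) (K Q : Fin q → JetFun p q) : Prop :=
  ∀ ν : Fin q, IsLittleO Ω k (fun z => totalDt K (Q ν) z - prEvol Q (K ν) z)

/-- `∫ F dx` determines an approximate conservation law of `u_t = K`:
`D_t F + Div X = o(ε^k)` on solutions, for some flux `X`. -/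
def IsApproxConservationLaw {p q : ℕ} (Ω : Domain p q) (k : ℕ) (K : Fin q → JetFun p q)
    (F : JetFun p q) : Prop :=
  ∃ X : Fin p → JetFun p q, (∀ i, IsDiffFun Ω (X i)) ∧
    IsLittleO Ω k (fun z => totalDt K F z + totalDiv X z)

/-- `∫ G dx` is an approximate distinguished functional for `𝒟`: `𝒟 δG = o(ε^k)`. It may depend
explicitly on `t`. -/
def IsApproxDistinguished {p q : ℕ} (Ω : Domain p q) (k : ℕ) (𝒟 : MatDiffOp p q)
    (G : JetFun p q) : Prop :=
  ∀ α : Fin q, IsLittleO Ω k (𝒟.apply (euler G) α)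

end PerturbedHamiltonian

end

/-!
The differential functions modulo `o(ε^k)` form a commutative algebra on which `∂/∂t`, `∂/∂x^i`,
`∂/∂u^α_J`, hence also `D_i`, `E` and `pr v_Q`, act, so `≈` becomes an equality there and the
argument is that of the unperturbed theorem.

Write `v_P` for `pr v_{𝒟 δP}`. Modulo divergences `v_P (R)` is the bracket `{R, P}`, so the Jacobi
identity says that the characteristics of `[v_H, v_P]` and of `v_{{P, H}}` have the same pairing
with `δR` for every `R`, and the densities `R = x^I u^α` and `R = (u^α)²` detect every
characteristic.
As `𝒟` does not depend on `t`, the defect of the symmetry condition for `Q = 𝒟 δP` is therefore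
`D_t Q - pr v_Q (K) = 𝒟 δ(∂_t P + {P, H})`, where `∂_t P + {P, H}` is `D_t P` up to a divergence.
So `v_P` is a symmetry exactly if `∫ D_t P dx` is distinguished. A distinguished `G` has
`D_t G = ∂_t G` up to a divergence by skew-symmetry, so the task is to write a density of
`∫ D_t P dx` as `∂_t G` with `G` distinguished: the primitive in time that vanishes at a fixed `t₀`
is such a `G`, and `P - G` is then conserved.
-/

open scoped ContDiff Topology

noncomputable section

namespace PerturbedHamiltonian

/-! ### Multi-indices -/

namespace MultiIndex

variable {p : ℕ}

theorem exists_eq_add_single {J : MultiIndex p} {i : Fin p} (h : J i ≠ 0) :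
    ∃ J' : MultiIndex p, J = J' + Pi.single i 1 :=
  ⟨J - Pi.single i 1, (tsub_add_cancel_of_le <| update_le_iff.2
    ⟨Nat.one_le_iff_ne_zero.2 h, fun _ _ => Nat.zero_le _⟩).symm⟩

theorem induction_add_single {C : MultiIndex p → Prop} (zero : C 0)
    (add_single : ∀ J i, C J → C (J + Pi.single i 1)) (J : MultiIndex p) : C J := by
  induction J using WellFoundedLT.induction with
  | ind J ih =>
    by_cases hJ : J = 0
    · exact hJ ▸ zero
    · obtain ⟨i, hi⟩ := Function.ne_iff.1 hJ
      obtain ⟨J', rfl⟩ := exists_eq_add_single hi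
      exact add_single J' i (ih J' (lt_add_of_pos_right J' (Pi.single_pos.2 Nat.one_pos)))

theorem sum_add_single (J : MultiIndex p) (i : Fin p) :
    ∑ j, (J + Pi.single i 1 : MultiIndex p) j = ∑ j, J j + 1 := by
  simp [Finset.sum_add_distrib]

theorem finsum_add_single {M : Type*} [AddCommMonoid M] {h : MultiIndex p → M} {i : Fin p}
    (h0 : ∀ J, J i = 0 → h J = 0) : ∑ᶠ J : MultiIndex p, h (J + Pi.single i 1) = ∑ᶠ J, h J := by
  have hinj : Function.Injective fun J : MultiIndex p => J + Pi.single i 1 :=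
    add_left_injective _
  rw [← finsum_mem_range (f := h) hinj, ← finsum_mem_univ h]
  refine finsum_mem_inter_support_eq' _ _ _ fun J hJ => iff_of_true ?_ trivial
  obtain ⟨J', rfl⟩ := exists_eq_add_single (mt (h0 J) hJ)
  exact ⟨J', rfl⟩

end MultiIndex

theorem prod_pow_add_single {p : ℕ} {M : Type*} [Monoid M] {E : Fin p → M}
    (hE : ∀ i j, Commute (E i) (E j)) {l : List (Fin p)} (hl : l.Nodup) {i : Fin p} (hi : i ∈ l)
    (J : MultiIndex p) :
    (l.map fun j => E j ^ (J + Pi.single i 1 : MultiIndex p) j).prod =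
      E i * (l.map fun j => E j ^ J j).prod := by
  induction l with
  | nil => simp at hi
  | cons j l ih =>
    rw [List.nodup_cons] at hl
    simp only [List.map_cons, List.prod_cons, ← mul_assoc]
    obtain rfl | ⟨hij, hi⟩ := List.eq_or_ne_mem_of_mem hi
    · have hJ : ∀ k ∈ l, E k ^ (J + Pi.single i 1 : MultiIndex p) k = E k ^ J k := fun k hk => by
        rw [Pi.add_apply, Pi.single_eq_of_ne (ne_of_mem_of_not_mem hk hl.1), add_zero]
      rw [List.map_congr_left hJ, Pi.add_apply, Pi.single_eq_same, pow_succ']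
    · rw [ih hl.2 hi, ← mul_assoc, Pi.add_apply, Pi.single_eq_of_ne hij.symm, add_zero,
        ((hE j i).pow_left _).eq]

/-! ### Vertical vector fields -/

theorem lie_eq_zero_iff {B : Type*} [CommRing B] [Algebra ℝ B] {δ ε : Derivation ℝ B B} :
    ⁅δ, ε⁆ = 0 ↔ ∀ f, δ (ε f) = ε (δ f) := by
  simp only [Derivation.ext_iff, Derivation.commutator_apply, Derivation.zero_apply, sub_eq_zero]

/-- An algebraic model of the algebra of differential functions: a commutative algebra with
commuting, locally finite partial derivatives along the jet coordinates. The equations `d_coord`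
leave out `d .eps`, because `∂/∂ε` does not descend to the quotient modulo `o(ε^k)`. -/
structure JetAlgebra (p q : ℕ) (B : Type*) [CommRing B] [Algebra ℝ B] where
  d : Coord p q → Derivation ℝ B B
  coord : Coord p q → B
  d_coord : ∀ c e, c ≠ .eps → d c (coord e) = if c = e then 1 else 0
  d_comm : ∀ c e f, d c (d e f) = d e (d c f)
  finite_support : ∀ f, {c | d c f ≠ 0}.Finite

namespace JetAlgebra

variable {p q : ℕ} {B : Type*} [CommRing B] [Algebra ℝ B] (𝒥 : JetAlgebra p q B)

/-- The partial derivative `∂/∂u^α_J` for `s = (α, J)`. -/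
def dj (s : Fin q × MultiIndex p) : Derivation ℝ B B := 𝒥.d (.jet s.1 s.2)

/-- The jet variable `u^α_J` for `s = (α, J)`. -/
def u (s : Fin q × MultiIndex p) : B := 𝒥.coord (.jet s.1 s.2)

theorem dj_u (r s : Fin q × MultiIndex p) : 𝒥.dj r (𝒥.u s) = if r = s then 1 else 0 := by
  rw [dj, u, 𝒥.d_coord _ _ (by simp)]
  congr 1
  simp [Prod.ext_iff]

theorem dj_coord_space (s : Fin q × MultiIndex p) (i : Fin p) :
    𝒥.dj s (𝒥.coord (.space i)) = 0 := by
  simp [dj, 𝒥.d_coord]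

theorem d_space_u (i : Fin p) (s : Fin q × MultiIndex p) : 𝒥.d (.space i) (𝒥.u s) = 0 := by
  simp [u, 𝒥.d_coord]

theorem d_time_u (s : Fin q × MultiIndex p) : 𝒥.d .time (𝒥.u s) = 0 := by
  simp [u, 𝒥.d_coord]

theorem d_dj (c : Coord p q) (s : Fin q × MultiIndex p) (f : B) :
    𝒥.d c (𝒥.dj s f) = 𝒥.dj s (𝒥.d c f) :=
  𝒥.d_comm _ _ _

theorem hasFiniteSupport_dj (f : B) : (fun s => 𝒥.dj s f).HasFiniteSupport :=
  (𝒥.finite_support f).preimage (f := fun s : Fin q × MultiIndex p => Coord.jet s.1 s.2)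
    fun r _ s _ h => by simpa [Prod.ext_iff] using h

theorem exists_support (f : B) :
    ∃ S : Finset (Fin q × MultiIndex p), ∀ s ∉ S, 𝒥.dj s f = 0 :=
  let ⟨S, hS⟩ := Set.Finite.exists_finset (𝒥.hasFiniteSupport_dj f)
  ⟨S, fun s => not_imp_comm.1 (hS s).2⟩

theorem hasFiniteSupport_dj_jet (α : Fin q) (f : B) :
    (fun J => 𝒥.dj (α, J) f).HasFiniteSupport :=
  (𝒥.hasFiniteSupport_dj f).preimage (Prod.mk_right_injective α).injOn

/-- The vertical vector field `∑ a^α_J ∂/∂u^α_J`. -/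
def vert (a : Fin q × MultiIndex p → B) : Derivation ℝ B B :=
  Derivation.mk'
    { toFun f := ∑ᶠ s, a s * 𝒥.dj s f
      map_add' f g := by
        simp only [map_add, mul_add]
        exact finsum_add_distrib ((𝒥.hasFiniteSupport_dj f).mul_right a)
          ((𝒥.hasFiniteSupport_dj g).mul_right a)
      map_smul' r f := by
        simp only [Derivation.map_smul, mul_smul_comm, RingHom.id_apply]
        exact (smul_finsum' r ((𝒥.hasFiniteSupport_dj f).mul_right a)).symm }
    fun f g => by
      have hf : (fun s => a s * 𝒥.dj s f).HasFiniteSupport :=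
        (𝒥.hasFiniteSupport_dj f).mul_right a
      have hg : (fun s => a s * 𝒥.dj s g).HasFiniteSupport :=
        (𝒥.hasFiniteSupport_dj g).mul_right a
      simp only [LinearMap.coe_mk, AddHom.coe_mk, smul_eq_mul, mul_finsum' _ _ hf,
        mul_finsum' _ _ hg]
      refine .trans ?_ (finsum_add_distrib (hg.mul_right fun _ => f) (hf.mul_right fun _ => g))
      refine finsum_congr fun s => ?_
      rw [Derivation.leibniz, smul_eq_mul, smul_eq_mul]
      ring

theorem vert_apply (a : Fin q × MultiIndex p → B) (f : B) :
    𝒥.vert a f = ∑ᶠ s, a s * 𝒥.dj s f := rfl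

theorem vert_eq_sum (a : Fin q × MultiIndex p → B) {f : B} {S : Finset (Fin q × MultiIndex p)}
    (hS : ∀ s ∉ S, 𝒥.dj s f = 0) : 𝒥.vert a f = ∑ s ∈ S, a s * 𝒥.dj s f :=
  finsum_eq_sum_of_support_subset _ fun s hs => by
    by_contra h
    exact hs (by simp [hS s h])

theorem vert_eq_sum_finsum (a : Fin q × MultiIndex p → B) (f : B) :
    𝒥.vert a f = ∑ α, ∑ᶠ J, a (α, J) * 𝒥.dj (α, J) f := by
  rw [vert_apply, finsum_curry (fun s => a s * 𝒥.dj s f) ((𝒥.hasFiniteSupport_dj f).mul_right a),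
    finsum_eq_sum_of_fintype]

theorem vert_u (a : Fin q × MultiIndex p → B) (s : Fin q × MultiIndex p) :
    𝒥.vert a (𝒥.u s) = a s := by
  rw [vert_apply, finsum_eq_single _ s fun r hr => by simp [dj_u, hr]]
  simp [dj_u]

theorem vert_single (s : Fin q × MultiIndex p) : 𝒥.vert (Pi.single s 1) = 𝒥.dj s := by
  ext f
  rw [vert_apply, finsum_eq_single _ s fun r hr => by simp [hr]]
  simp

@[simp] theorem vert_zero : 𝒥.vert 0 = 0 := by
  ext f
  simp [vert_apply]

theorem vert_add (a b : Fin q × MultiIndex p → B) : 𝒥.vert (a + b) = 𝒥.vert a + 𝒥.vert b := by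
  ext f
  simp only [vert_apply, Derivation.add_apply, Pi.add_apply, add_mul]
  exact finsum_add_distrib ((𝒥.hasFiniteSupport_dj f).mul_right a)
    ((𝒥.hasFiniteSupport_dj f).mul_right b)

theorem vert_sub (a b : Fin q × MultiIndex p → B) : 𝒥.vert (a - b) = 𝒥.vert a - 𝒥.vert b := by
  rw [eq_sub_iff_add_eq, ← vert_add, sub_add_cancel]

theorem map_vert (δ : Derivation ℝ B B) (a : Fin q × MultiIndex p → B) (f : B) :
    δ (𝒥.vert a f) = 𝒥.vert (fun s => δ (a s)) f + ∑ᶠ s, a s * δ (𝒥.dj s f) := by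
  have hf := 𝒥.hasFiniteSupport_dj f
  have hδ : (fun s => δ (𝒥.dj s f)).HasFiniteSupport := hf.subset fun s hs h => hs (by simp_all)
  rw [vert_apply, vert_apply]
  refine (map_finsum δ (hf.mul_right a)).trans ?_
  refine .trans ?_ (finsum_add_distrib (hf.mul_right fun s => δ (a s)) (hδ.mul_right a))
  refine finsum_congr fun s => ?_
  simp only [Pi.mul_apply, Derivation.leibniz, smul_eq_mul]
  ring

theorem lie_vert {δ : Derivation ℝ B B} (hδ : ∀ s f, δ (𝒥.dj s f) = 𝒥.dj s (δ f))
    (a : Fin q × MultiIndex p → B) : ⁅δ, 𝒥.vert a⁆ = 𝒥.vert fun s => δ (a s) := by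
  ext f
  simp only [Derivation.commutator_apply, map_vert, hδ, ← vert_apply, add_sub_cancel_right]

theorem finsum_mul_vert_dj (a b : Fin q × MultiIndex p → B) (f : B) :
    ∑ᶠ s, a s * 𝒥.vert b (𝒥.dj s f) = ∑ᶠ s, b s * 𝒥.vert a (𝒥.dj s f) := by
  obtain ⟨S, hS⟩ := 𝒥.exists_support f
  have hsum (a b : Fin q × MultiIndex p → B) :
      ∑ᶠ s, a s * 𝒥.vert b (𝒥.dj s f) =
        ∑ s ∈ S, ∑ r ∈ S, a s * (b r * 𝒥.dj r (𝒥.dj s f)) := by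
    rw [finsum_eq_sum_of_support_subset (s := S)]
    · refine Finset.sum_congr rfl fun s _ => ?_
      rw [𝒥.vert_eq_sum b (S := S), Finset.mul_sum]
      intro r hr
      rw [dj, 𝒥.d_dj, ← dj, hS r hr, map_zero]
    · intro s hs
      by_contra h
      exact hs (by simp [hS s h])
  rw [hsum a b, hsum b a, Finset.sum_comm]
  refine Finset.sum_congr rfl fun r _ => Finset.sum_congr rfl fun s _ => ?_
  rw [dj, 𝒥.d_dj, ← dj]
  ring

theorem vert_lie_vert (a b : Fin q × MultiIndex p → B) :
    ⁅𝒥.vert a, 𝒥.vert b⁆ = 𝒥.vert fun s => 𝒥.vert a (b s) - 𝒥.vert b (a s) := by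
  ext f
  rw [Derivation.commutator_apply, map_vert, map_vert, 𝒥.finsum_mul_vert_dj a b f,
    add_sub_add_right_eq_sub, ← Derivation.sub_apply, ← vert_sub]
  rfl

/-! ### Total derivatives and evolutionary vector fields -/

/-- The total derivative `D_i`. -/
def D (i : Fin p) : Derivation ℝ B B :=
  𝒥.d (.space i) + 𝒥.vert fun s => 𝒥.u (s.1, s.2 + Pi.single i 1)

theorem D_u (i : Fin p) (s : Fin q × MultiIndex p) :
    𝒥.D i (𝒥.u s) = 𝒥.u (s.1, s.2 + Pi.single i 1) := by
  rw [D, Derivation.add_apply, 𝒥.vert_u, d_space_u, zero_add]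

theorem lie_D {δ : Derivation ℝ B B} (hdj : ∀ s f, δ (𝒥.dj s f) = 𝒥.dj s (δ f))
    {i : Fin p} (hd : ∀ f, δ (𝒥.d (.space i) f) = 𝒥.d (.space i) (δ f)) :
    ⁅δ, 𝒥.D i⁆ = 𝒥.vert fun s => δ (𝒥.u (s.1, s.2 + Pi.single i 1)) := by
  rw [D, lie_add, lie_eq_zero_iff.2 hd, zero_add, 𝒥.lie_vert hdj]

theorem vert_lie_D (a : Fin q × MultiIndex p → B) (i : Fin p) :
    ⁅𝒥.vert a, 𝒥.D i⁆ = 𝒥.vert fun s => a (s.1, s.2 + Pi.single i 1) - 𝒥.D i (a s) := by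
  rw [D, lie_add, ← lie_skew (𝒥.vert a), 𝒥.lie_vert (𝒥.d_dj _), vert_lie_vert, neg_add_eq_sub,
    ← vert_sub]
  congr 1
  ext s
  simp only [Pi.sub_apply, vert_u, Derivation.add_apply]
  ring

theorem dj_lie_D (r : Fin q × MultiIndex p) (i : Fin p) :
    ⁅𝒥.dj r, 𝒥.D i⁆ = 𝒥.vert fun s => if r = (s.1, s.2 + Pi.single i 1) then 1 else 0 := by
  simp only [𝒥.lie_D (δ := 𝒥.dj r) (𝒥.d_dj _) (𝒥.d_comm _ _), dj_u]

theorem dj_add_single_D (α : Fin q) (J : MultiIndex p) (i : Fin p) (f : B) :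
    𝒥.dj (α, J + Pi.single i 1) (𝒥.D i f) =
      𝒥.D i (𝒥.dj (α, J + Pi.single i 1) f) + 𝒥.dj (α, J) f := by
  rw [← sub_eq_iff_eq_add', ← Derivation.commutator_apply, dj_lie_D, ← 𝒥.vert_single (α, J)]
  congr 2
  ext s
  simp [Pi.single_apply, Prod.ext_iff, eq_comm]

theorem dj_D_of_eq_zero (α : Fin q) {J : MultiIndex p} {i : Fin p} (hJ : J i = 0) (f : B) :
    𝒥.dj (α, J) (𝒥.D i f) = 𝒥.D i (𝒥.dj (α, J) f) := by
  refine lie_eq_zero_iff.1 ?_ f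
  rw [dj_lie_D, ← vert_zero]
  congr 1
  ext s
  refine if_neg fun h => ?_
  obtain ⟨-, rfl⟩ := Prod.ext_iff.1 h
  simp at hJ

theorem D_comm (i j : Fin p) (f : B) : 𝒥.D i (𝒥.D j f) = 𝒥.D j (𝒥.D i f) := by
  refine lie_eq_zero_iff.1 ?_ f
  conv_lhs => lhs; rw [D]
  rw [add_lie, vert_lie_D, 𝒥.lie_D (𝒥.d_dj _) (𝒥.d_comm _ _), ← vert_add, ← vert_zero]
  congr 1
  ext s
  simp [D_u, d_space_u, add_right_comm]

theorem d_time_D (i : Fin p) (f : B) : 𝒥.d .time (𝒥.D i f) = 𝒥.D i (𝒥.d .time f) := by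
  refine lie_eq_zero_iff.1 ?_ f
  rw [𝒥.lie_D (𝒥.d_dj _) (𝒥.d_comm _ _), ← vert_zero]
  congr 1
  ext s
  exact 𝒥.d_time_u _

/-- The iterated total derivative `D_J`. -/
def DJ (J : MultiIndex p) : Module.End ℝ B :=
  ((List.finRange p).map fun i => (𝒥.D i : Module.End ℝ B) ^ J i).prod

theorem DJ_zero : 𝒥.DJ 0 = 1 := by
  simp [DJ]

theorem DJ_add_single (J : MultiIndex p) (i : Fin p) (f : B) :
    𝒥.DJ (J + Pi.single i 1) f = 𝒥.D i (𝒥.DJ J f) := by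
  have h := prod_pow_add_single (E := fun i => (𝒥.D i : Module.End ℝ B))
    (fun i j => LinearMap.ext (𝒥.D_comm i j))
    (List.nodup_finRange p) (List.mem_finRange i) J
  exact LinearMap.congr_fun h f

theorem DJ_commute {φ : Module.End ℝ B} (hφ : ∀ i f, φ (𝒥.D i f) = 𝒥.D i (φ f))
    (J : MultiIndex p) (f : B) : φ (𝒥.DJ J f) = 𝒥.DJ J (φ f) := by
  induction J using MultiIndex.induction_add_single with
  | zero => simp [DJ_zero]
  | add_single J i ih => rw [DJ_add_single, hφ, ih, DJ_add_single]

/-- The prolongation of the evolutionary vector field with characteristic `Q`. -/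
def pr (Q : Fin q → B) : Derivation ℝ B B := 𝒥.vert fun s => 𝒥.DJ s.2 (Q s.1)

/-- The total time derivative on solutions of `u_t = K`. -/
def Dt (K : Fin q → B) : Derivation ℝ B B := 𝒥.d .time + 𝒥.pr K

theorem pr_sub (P Q : Fin q → B) : 𝒥.pr (P - Q) = 𝒥.pr P - 𝒥.pr Q := by
  simp only [pr, ← vert_sub, Pi.sub_def, map_sub]

theorem pr_D (Q : Fin q → B) (i : Fin p) (f : B) : 𝒥.pr Q (𝒥.D i f) = 𝒥.D i (𝒥.pr Q f) := by
  refine lie_eq_zero_iff.1 ?_ f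
  simp only [pr, vert_lie_D, DJ_add_single, sub_self]
  exact 𝒥.vert_zero

theorem Dt_D (K : Fin q → B) (i : Fin p) (f : B) : 𝒥.Dt K (𝒥.D i f) = 𝒥.D i (𝒥.Dt K f) := by
  simp only [Dt, Derivation.add_apply, map_add, d_time_D, pr_D]

theorem pr_DJ (Q : Fin q → B) (J : MultiIndex p) (f : B) :
    𝒥.pr Q (𝒥.DJ J f) = 𝒥.DJ J (𝒥.pr Q f) :=
  𝒥.DJ_commute (φ := (𝒥.pr Q : Module.End ℝ B)) (𝒥.pr_D Q) J f

theorem pr_lie_pr (P Q : Fin q → B) :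
    ⁅𝒥.pr P, 𝒥.pr Q⁆ = 𝒥.pr fun α => 𝒥.pr P (Q α) - 𝒥.pr Q (P α) := by
  conv_lhs => rw [pr, pr, vert_lie_vert, ← pr, ← pr]
  simp only [pr_DJ, ← map_sub]
  rfl

/-! ### Divergences and the Euler operator -/

/-- The space of total divergences `∑ D_i X_i`. -/
def divRange : Submodule ℝ B :=
  LinearMap.range (∑ i, (𝒥.D i : B →ₗ[ℝ] B) ∘ₗ LinearMap.proj i)

theorem mem_divRange_iff {f : B} : f ∈ 𝒥.divRange ↔ ∃ X : Fin p → B, ∑ i, 𝒥.D i (X i) = f := by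
  simp [divRange]

theorem D_mem_divRange (i : Fin p) (f : B) : 𝒥.D i f ∈ 𝒥.divRange := by
  refine 𝒥.mem_divRange_iff.2 ⟨Pi.single i f, ?_⟩
  rw [Finset.sum_eq_single i (fun j _ hj => by simp [hj]) (by simp), Pi.single_eq_same]

theorem map_mem_divRange {φ : Module.End ℝ B} (hφ : ∀ i f, φ (𝒥.D i f) = 𝒥.D i (φ f)) {f : B}
    (hf : f ∈ 𝒥.divRange) : φ f ∈ 𝒥.divRange := by
  obtain ⟨X, rfl⟩ := 𝒥.mem_divRange_iff.1 hf
  exact 𝒥.mem_divRange_iff.2 ⟨fun i => φ (X i), by simp only [map_sum, hφ]⟩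

theorem Dt_smodEq (K : Fin q → B) {f g : B} (h : f ≡ g [SMOD 𝒥.divRange]) :
    𝒥.Dt K f ≡ 𝒥.Dt K g [SMOD 𝒥.divRange] := by
  rw [SModEq.sub_mem, ← map_sub]
  exact 𝒥.map_mem_divRange (φ := (𝒥.Dt K : Module.End ℝ B)) (𝒥.Dt_D K) (SModEq.sub_mem.1 h)

/-- The iterate `(-D)_J` of the negated total derivatives. -/
def negDJ (J : MultiIndex p) : Module.End ℝ B := (-1 : ℝ) ^ (∑ i, J i) • 𝒥.DJ J

theorem negDJ_zero : 𝒥.negDJ 0 = 1 := by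
  simp [negDJ, DJ_zero]

theorem negDJ_add_single (J : MultiIndex p) (i : Fin p) (f : B) :
    𝒥.negDJ (J + Pi.single i 1) f = -𝒥.D i (𝒥.negDJ J f) := by
  rw [negDJ, negDJ, MultiIndex.sum_add_single, LinearMap.smul_apply, DJ_add_single,
    LinearMap.smul_apply, Derivation.map_smul, pow_succ, mul_neg_one, neg_smul]

theorem negDJ_commute {φ : Module.End ℝ B} (hφ : ∀ i f, φ (𝒥.D i f) = 𝒥.D i (φ f))
    (J : MultiIndex p) (f : B) : φ (𝒥.negDJ J f) = 𝒥.negDJ J (φ f) := by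
  simp only [negDJ, LinearMap.smul_apply, map_smul, 𝒥.DJ_commute hφ]

theorem D_negDJ (i : Fin p) (J : MultiIndex p) (f : B) :
    𝒥.D i (𝒥.negDJ J f) = 𝒥.negDJ J (𝒥.D i f) :=
  𝒥.negDJ_commute (φ := (𝒥.D i : Module.End ℝ B)) (fun j => 𝒥.D_comm i j) J f

theorem hasFiniteSupport_negDJ {a : MultiIndex p → B} (ha : a.HasFiniteSupport) :
    (fun J => 𝒥.negDJ J (a J)).HasFiniteSupport :=
  ha.subset fun J hJ h => hJ (by simp only [h, map_zero])

/-- The Euler operator `E_α = ∑ (-D)_J ∂/∂u^α_J`. -/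
def euler : B →ₗ[ℝ] Fin q → B where
  toFun f α := ∑ᶠ J, 𝒥.negDJ J (𝒥.dj (α, J) f)
  map_add' f g := by
    ext α
    simp only [map_add, Pi.add_apply]
    exact finsum_add_distrib (𝒥.hasFiniteSupport_negDJ (𝒥.hasFiniteSupport_dj_jet α f))
      (𝒥.hasFiniteSupport_negDJ (𝒥.hasFiniteSupport_dj_jet α g))
  map_smul' r f := by
    ext α
    simp only [Derivation.map_smul, map_smul, Pi.smul_apply, RingHom.id_apply]
    exact (smul_finsum' r (𝒥.hasFiniteSupport_negDJ (𝒥.hasFiniteSupport_dj_jet α f))).symm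

theorem euler_apply (f : B) (α : Fin q) : 𝒥.euler f α = ∑ᶠ J, 𝒥.negDJ J (𝒥.dj (α, J) f) := rfl

theorem euler_eq_single {α : Fin q} {f : B} (hf : ∀ J ≠ 0, 𝒥.dj (α, J) f = 0) :
    𝒥.euler f α = 𝒥.dj (α, 0) f := by
  rw [euler_apply, finsum_eq_single _ 0 fun J hJ => by rw [hf J hJ, map_zero], negDJ_zero]
  rfl

theorem d_time_euler (f : B) (α : Fin q) : 𝒥.d .time (𝒥.euler f α) = 𝒥.euler (𝒥.d .time f) α := by
  refine (map_finsum (𝒥.d .time)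
    (𝒥.hasFiniteSupport_negDJ (𝒥.hasFiniteSupport_dj_jet α f))).trans (finsum_congr fun J => ?_)
  rw [← 𝒥.d_dj]
  exact 𝒥.negDJ_commute (φ := (𝒥.d .time : Module.End ℝ B)) 𝒥.d_time_D J _

/-- The commutator `[∂/∂u^α_{J,i}, D_i] = ∂/∂u^α_J` makes the sum telescope. -/
theorem euler_D (i : Fin p) (f : B) : 𝒥.euler (𝒥.D i f) = 0 := by
  ext α
  set g : MultiIndex p → B := fun J => 𝒥.negDJ J (𝒥.D i (𝒥.dj (α, J) f)) with hg
  set h : MultiIndex p → B := fun J => 𝒥.negDJ J (𝒥.dj (α, J) (𝒥.D i f)) - g J with hh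
  have hgf : g.HasFiniteSupport := 𝒥.hasFiniteSupport_negDJ <|
    (𝒥.hasFiniteSupport_dj_jet α f).subset fun J hJ h => hJ (by simp only [h, map_zero])
  have hhf : h.HasFiniteSupport :=
    .subset ((𝒥.hasFiniteSupport_negDJ (𝒥.hasFiniteSupport_dj_jet α (𝒥.D i f))).union hgf)
      (Function.support_sub _ _)
  have h_zero : ∀ J, J i = 0 → h J = 0 := fun J hJ => by
    simp only [hh, hg, 𝒥.dj_D_of_eq_zero α hJ, sub_self]
  have h_add_single : ∀ J, h (J + Pi.single i 1) = -g J := fun J => by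
    simp only [hh, hg, dj_add_single_D, map_add, add_sub_cancel_left, negDJ_add_single, D_negDJ]
  calc 𝒥.euler (𝒥.D i f) α
      = ∑ᶠ J, (g J + h J) := finsum_congr fun J => by simp only [hh, add_sub_cancel]
    _ = ∑ᶠ J, g J + ∑ᶠ J : MultiIndex p, h (J + Pi.single i 1) := by
      rw [finsum_add_distrib hgf hhf, MultiIndex.finsum_add_single h_zero]
    _ = 0 := by simp only [h_add_single, finsum_neg_distrib, add_neg_cancel]

theorem euler_eq_of_smodEq {f g : B} (h : f ≡ g [SMOD 𝒥.divRange]) : 𝒥.euler f = 𝒥.euler g := by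
  obtain ⟨X, hX⟩ := 𝒥.mem_divRange_iff.1 (SModEq.sub_mem.1 h)
  rw [← sub_eq_zero, ← map_sub, ← hX, map_sum]
  exact Finset.sum_eq_zero fun i _ => 𝒥.euler_D i (X i)

theorem euler_eq_zero_of_mem {f : B} (hf : f ∈ 𝒥.divRange) : 𝒥.euler f = 0 :=
  (𝒥.euler_eq_of_smodEq (SModEq.zero.2 hf)).trans (map_zero _)

theorem DJ_mul_smodEq (J : MultiIndex p) (f g : B) :
    𝒥.DJ J f * g ≡ f * 𝒥.negDJ J g [SMOD 𝒥.divRange] := by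
  induction J using MultiIndex.induction_add_single generalizing g with
  | zero => simp only [DJ_zero, negDJ_zero, Module.End.one_apply, SModEq.rfl]
  | add_single J i ih =>
    calc 𝒥.DJ (J + Pi.single i 1) f * g
        = 𝒥.D i (𝒥.DJ J f * g) - 𝒥.DJ J f * 𝒥.D i g := by
          rw [DJ_add_single, Derivation.leibniz, smul_eq_mul, smul_eq_mul]
          ring
      _ ≡ 0 - f * 𝒥.negDJ J (𝒥.D i g) [SMOD 𝒥.divRange] :=
          (SModEq.zero.2 (𝒥.D_mem_divRange i _)).sub (ih (𝒥.D i g))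
      _ = f * 𝒥.negDJ (J + Pi.single i 1) g := by
          rw [negDJ_add_single, D_negDJ]
          ring

theorem pr_smodEq_euler_mul (Q : Fin q → B) (f : B) :
    𝒥.pr Q f ≡ ∑ α, 𝒥.euler f α * Q α [SMOD 𝒥.divRange] := by
  obtain ⟨S, hS⟩ := 𝒥.exists_support f
  set T := S.image Prod.snd
  have hJ (α : Fin q) (J) (hJ : J ∉ T) : 𝒥.dj (α, J) f = 0 :=
    hS _ fun h => hJ (Finset.mem_image_of_mem Prod.snd h)
  have heuler (α : Fin q) : 𝒥.euler f α * Q α = ∑ J ∈ T, Q α * 𝒥.negDJ J (𝒥.dj (α, J) f) := by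
    rw [euler_apply, finsum_eq_sum_of_support_subset (s := T), Finset.sum_mul]
    · simp only [mul_comm]
    · exact fun J h => by_contra fun hJT => h (by simp only [hJ α J hJT, map_zero])
  rw [pr, 𝒥.vert_eq_sum _ (S := Finset.univ ×ˢ T) (by simpa using hJ), Finset.sum_product]
  simp only [heuler]
  exact .sum fun α _ => .sum fun J _ => 𝒥.DJ_mul_smodEq J (Q α) _

/-! ### Nondegeneracy of the pairing with variational derivatives -/

theorem D_coord_space (i j : Fin p) :
    𝒥.D j (𝒥.coord (.space i)) = if j = i then 1 else 0 := by
  simp [D, vert_apply, dj_coord_space, 𝒥.d_coord]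

/-- The truncated subtraction `J - Pi.single i 1` is harmless: its coefficient is `J i`. -/
theorem negDJ_coord_mul (i : Fin p) (J : MultiIndex p) (g : B) :
    𝒥.negDJ J (𝒥.coord (.space i) * g) =
      𝒥.coord (.space i) * 𝒥.negDJ J g - (J i : ℝ) • 𝒥.negDJ (J - Pi.single i 1) g := by
  induction J using MultiIndex.induction_add_single with
  | zero => simp [negDJ_zero]
  | add_single J j ih =>
    have lower : (if j = i then 𝒥.negDJ J g else 0) -
          (J i : ℝ) • 𝒥.D j (𝒥.negDJ (J - Pi.single i 1) g) =
        ((J + Pi.single j 1 : MultiIndex p) i : ℝ) •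
          𝒥.negDJ (J + Pi.single j 1 - Pi.single i 1) g := by
      by_cases hJ : J i = 0
      · obtain rfl | hj := eq_or_ne j i
        · simp [hJ]
        · simp [hJ, hj, hj.symm]
      · obtain ⟨J, rfl⟩ := MultiIndex.exists_eq_add_single hJ
        rw [add_tsub_cancel_right, add_right_comm, add_tsub_cancel_right]
        obtain rfl | hj := eq_or_ne j i
        · simp [negDJ_add_single, add_smul]
          abel
        · simp [hj, hj.symm, negDJ_add_single]
    rw [negDJ_add_single, ih, map_sub, Derivation.leibniz, D_coord_space, ← lower,
      negDJ_add_single, Derivation.map_smul, smul_eq_mul, smul_eq_mul]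
    split_ifs <;> ring

/-- The formal adjoint `∑ (-D)_J ∘ a_J` of the differential operator `∑ a_J D_J`. -/
def adj (a : MultiIndex p → B) (f : B) : B := ∑ᶠ J, 𝒥.negDJ J (f * a J)

/-- The derivative `∂σ/∂ξ_i` of the symbol `σ = ∑ a_J ξ^J` of the differential operator
`∑ a_J D_J`. -/
def symbolDeriv (i : Fin p) (a : MultiIndex p → B) (J : MultiIndex p) : B :=
  ((J i + 1 : ℕ) : ℝ) • a (J + Pi.single i 1)

theorem adj_symbolDeriv {a : MultiIndex p → B} (ha : a.HasFiniteSupport) (i : Fin p) (f : B) :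
    𝒥.adj (symbolDeriv i a) f =
      𝒥.coord (.space i) * 𝒥.adj a f - 𝒥.adj a (𝒥.coord (.space i) * f) := by
  have hfin (f) : (fun J => 𝒥.negDJ J (f * a J)).HasFiniteSupport :=
    𝒥.hasFiniteSupport_negDJ (ha.mul_right fun _ => f)
  rw [adj, adj, adj, mul_finsum' _ _ (hfin f)]
  refine .trans ?_ (finsum_sub_distrib ((hfin f).mul_right fun _ => _) (hfin _))
  simp only [mul_assoc, negDJ_coord_mul, sub_sub_cancel]
  refine .trans ?_ (MultiIndex.finsum_add_single (i := i) fun J hJ => by simp [hJ])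
  exact finsum_congr fun J => by simp [symbolDeriv, add_tsub_cancel_right]

/-- The monomials in the independent variables. -/
def monomials : Submonoid B := Submonoid.closure (Set.range fun i => 𝒥.coord (.space i))

theorem coord_mul_mem_monomials (i : Fin p) {f : B} (hf : f ∈ 𝒥.monomials) :
    𝒥.coord (.space i) * f ∈ 𝒥.monomials :=
  mul_mem (Submonoid.subset_closure ⟨i, rfl⟩) hf

theorem dj_monomial {f : B} (hf : f ∈ 𝒥.monomials) (s : Fin q × MultiIndex p) :
    𝒥.dj s f = 0 := by
  induction hf using Submonoid.closure_induction with
  | mem x hx =>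
    obtain ⟨i, rfl⟩ := hx
    exact 𝒥.dj_coord_space s i
  | one => exact Derivation.map_one_eq_zero _
  | mul x y _ _ hx hy => rw [Derivation.leibniz, hx, hy, smul_zero, smul_zero, add_zero]

theorem eq_zero_of_adj_eq_zero {a : MultiIndex p → B} (ha : a.HasFiniteSupport)
    (h : ∀ f ∈ 𝒥.monomials, 𝒥.adj a f = 0) : a = 0 := by
  obtain ⟨n, hn⟩ : ∃ n, ∀ J, n ≤ ∑ i, J i → a J = 0 := by
    obtain ⟨T, hT⟩ := Set.Finite.exists_finset ha
    refine ⟨T.sup (fun J => ∑ i, J i) + 1, fun J hJ => by_contra fun h0 => ?_⟩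
    exact (Nat.lt_of_succ_le hJ).not_ge
      (Finset.le_sup (f := fun J : MultiIndex p => ∑ i, J i) ((hT J).2 h0))
  induction n generalizing a with
  | zero => exact funext fun J => hn J (Nat.zero_le _)
  | succ n ih =>
    have hderiv (i : Fin p) : symbolDeriv i a = 0 := by
      refine ih ?_ (fun f hf => ?_) fun J hJ => ?_
      · exact (ha.preimage (add_left_injective _).injOn).subset fun J hJ h =>
          hJ (by rw [symbolDeriv, h, smul_zero])
      · rw [𝒥.adj_symbolDeriv ha, h f hf, h _ (𝒥.coord_mul_mem_monomials i hf), mul_zero, sub_zero]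
      · rw [symbolDeriv, hn _ (by rw [MultiIndex.sum_add_single]; omega), smul_zero]
    have hne : ∀ J ≠ 0, a J = 0 := fun J hJ => by
      obtain ⟨i, hi⟩ := Function.ne_iff.1 hJ
      obtain ⟨J, rfl⟩ := MultiIndex.exists_eq_add_single hi
      exact (smul_eq_zero_iff_right (by positivity)).1 (congrFun (hderiv i) J)
    have h0 : a 0 = 0 := by
      rw [← h 1 (one_mem _), adj, finsum_eq_single _ 0 fun J hJ => by simp [hne J hJ], negDJ_zero,
        one_mul, Module.End.one_apply]
    exact funext fun J => if hJ : J = 0 then hJ ▸ h0 else hne J hJ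

theorem dj_eq_zero_of_euler_monomial_mul {A : B} (hA : ∀ f ∈ 𝒥.monomials, 𝒥.euler (f * A) = 0)
    (s : Fin q × MultiIndex p) : 𝒥.dj s A = 0 := by
  refine congrFun (𝒥.eq_zero_of_adj_eq_zero (𝒥.hasFiniteSupport_dj_jet s.1 A) fun f hf => ?_) s.2
  refine .trans (finsum_congr fun J => ?_) (congrFun (hA f hf) s.1)
  rw [Derivation.leibniz, 𝒥.dj_monomial hf, smul_zero, add_zero, smul_eq_mul]

theorem euler_mul_u {g : B} (hg : ∀ s, 𝒥.dj s g = 0) (α : Fin q) :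
    𝒥.euler (g * 𝒥.u (α, 0)) = Pi.single α g := by
  ext β
  rw [euler_eq_single] <;> simp +contextual [hg, dj_u, Pi.single_apply]

theorem euler_u_mul_u (α : Fin q) :
    𝒥.euler (𝒥.u (α, 0) * 𝒥.u (α, 0)) = Pi.single α (2 * 𝒥.u (α, 0)) := by
  ext β
  rw [euler_eq_single] <;> simp +contextual [dj_u, Pi.single_apply, two_mul, ite_add_ite]

/-- Testing with `R = f u^α` for monomials `f` in the independent variables shows that `A α` does
not depend on the jet variables, and then `R = u^α u^α` shows that `A α` vanishes. -/
theorem eq_zero_of_pairing_mem {A : Fin q → B}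
    (hA : ∀ R, ∑ α, 𝒥.euler R α * A α ∈ 𝒥.divRange) : A = 0 := by
  have htest {R g : B} {α : Fin q} (hR : 𝒥.euler R = Pi.single α g) : 𝒥.euler (g * A α) = 0 := by
    have h := hA R
    simp only [hR, Pi.single_apply, ite_mul, zero_mul, Finset.sum_ite_eq', Finset.mem_univ,
      if_true] at h
    exact 𝒥.euler_eq_zero_of_mem h
  ext α
  have hdj : ∀ s, 𝒥.dj s (A α) = 0 := 𝒥.dj_eq_zero_of_euler_monomial_mul fun f hf =>
    htest (𝒥.euler_mul_u (𝒥.dj_monomial hf) α)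
  have h : 𝒥.euler ((2 : ℝ) • (A α * 𝒥.u (α, 0))) = 0 := by
    rw [← htest (𝒥.euler_u_mul_u α), two_smul]
    congr 1
    ring
  rw [map_smul, 𝒥.euler_mul_u hdj, ← Pi.single_smul, Pi.single_eq_zero_iff] at h
  exact (smul_eq_zero_iff_right two_ne_zero).1 h

/-! ### Hamiltonian operators -/

/-- The density `∑ E_α(P) 𝒟(E(L))_α` of the bracket defined by the operator `𝒟`. -/
def bracket (𝒟 : (Fin q → B) →+ (Fin q → B)) (P L : B) : B :=
  ∑ α, 𝒥.euler P α * 𝒟 (𝒥.euler L) α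

/-- `𝒟` is a Hamiltonian operator: its bracket is a Lie bracket modulo total divergences. -/
structure IsHamiltonian (𝒟 : (Fin q → B) →+ (Fin q → B)) : Prop where
  skew : ∀ P L, 𝒥.bracket 𝒟 P L ≡ -𝒥.bracket 𝒟 L P [SMOD 𝒥.divRange]
  jacobi : ∀ P L R, 𝒥.bracket 𝒟 (𝒥.bracket 𝒟 P L) R + 𝒥.bracket 𝒟 (𝒥.bracket 𝒟 L R) P +
    𝒥.bracket 𝒟 (𝒥.bracket 𝒟 R P) L ≡ 0 [SMOD 𝒥.divRange]

variable {𝒥} {𝒟 : (Fin q → B) →+ (Fin q → B)}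

theorem bracket_eq_of_smodEq_left {P P' : B} (h : P ≡ P' [SMOD 𝒥.divRange]) (L : B) :
    𝒥.bracket 𝒟 P L = 𝒥.bracket 𝒟 P' L := by
  rw [bracket, 𝒥.euler_eq_of_smodEq h, bracket]

theorem bracket_neg_left (P L : B) : 𝒥.bracket 𝒟 (-P) L = -𝒥.bracket 𝒟 P L := by
  simp only [bracket, map_neg, Pi.neg_apply, neg_mul, Finset.sum_neg_distrib]

theorem pr_smodEq_bracket (P L : B) :
    𝒥.pr (𝒟 (𝒥.euler L)) P ≡ 𝒥.bracket 𝒟 P L [SMOD 𝒥.divRange] :=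
  𝒥.pr_smodEq_euler_mul _ _

theorem pr_pr_smodEq_bracket (P L R : B) :
    𝒥.pr (𝒟 (𝒥.euler R)) (𝒥.pr (𝒟 (𝒥.euler L)) P) ≡
      𝒥.bracket 𝒟 (𝒥.bracket 𝒟 P L) R [SMOD 𝒥.divRange] :=
  bracket_eq_of_smodEq_left (𝒥 := 𝒥) (𝒟 := 𝒟) (pr_smodEq_bracket P L) R ▸ pr_smodEq_bracket _ R

theorem IsHamiltonian.pr_comm (h𝒟 : 𝒥.IsHamiltonian 𝒟) (P H : B) :
    (fun ν => 𝒥.pr (𝒟 (𝒥.euler H)) (𝒟 (𝒥.euler P) ν) -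
        𝒥.pr (𝒟 (𝒥.euler P)) (𝒟 (𝒥.euler H) ν)) =
      𝒟 (𝒥.euler (𝒥.bracket 𝒟 P H)) := by
  rw [← sub_eq_zero]
  refine 𝒥.eq_zero_of_pairing_mem fun R => SModEq.zero.1 ?_
  have hRH : 𝒥.bracket 𝒟 (𝒥.bracket 𝒟 R H) P = -𝒥.bracket 𝒟 (𝒥.bracket 𝒟 H R) P := by
    rw [bracket_eq_of_smodEq_left (h𝒟.skew R H), bracket_neg_left]
  refine (𝒥.pr_smodEq_euler_mul _ R).symm.trans ?_
  rw [pr_sub, ← pr_lie_pr, Derivation.sub_apply, Derivation.commutator_apply]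
  calc 𝒥.pr (𝒟 (𝒥.euler H)) (𝒥.pr (𝒟 (𝒥.euler P)) R) -
        𝒥.pr (𝒟 (𝒥.euler P)) (𝒥.pr (𝒟 (𝒥.euler H)) R) -
        𝒥.pr (𝒟 (𝒥.euler (𝒥.bracket 𝒟 P H))) R
      ≡ 𝒥.bracket 𝒟 (𝒥.bracket 𝒟 R P) H - 𝒥.bracket 𝒟 (𝒥.bracket 𝒟 R H) P -
        -𝒥.bracket 𝒟 (𝒥.bracket 𝒟 P H) R [SMOD 𝒥.divRange] :=
        ((pr_pr_smodEq_bracket R P H).sub (pr_pr_smodEq_bracket R H P)).sub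
          ((pr_smodEq_bracket R _).trans (h𝒟.skew R _))
    _ = 𝒥.bracket 𝒟 (𝒥.bracket 𝒟 P H) R + 𝒥.bracket 𝒟 (𝒥.bracket 𝒟 H R) P +
        𝒥.bracket 𝒟 (𝒥.bracket 𝒟 R P) H := by
        rw [hRH]
        abel
    _ ≡ 0 [SMOD 𝒥.divRange] := h𝒟.jacobi P H R

/-! ### The Noether correspondence -/

theorem IsHamiltonian.pr_smodEq_zero_of_distinguished (h𝒟 : 𝒥.IsHamiltonian 𝒟) {G : B}
    (hG : 𝒟 (𝒥.euler G) = 0) (H : B) : 𝒥.pr (𝒟 (𝒥.euler H)) G ≡ 0 [SMOD 𝒥.divRange] := by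
  refine (pr_smodEq_bracket G H).trans ((h𝒟.skew G H).trans ?_)
  simp only [bracket, hG, Pi.zero_apply, mul_zero, Finset.sum_const_zero, neg_zero, SModEq.rfl]

theorem Dt_smodEq_bracket (P H : B) :
    𝒥.Dt (𝒟 (𝒥.euler H)) P ≡ 𝒥.d .time P + 𝒥.bracket 𝒟 P H [SMOD 𝒥.divRange] :=
  .add .rfl (pr_smodEq_bracket P H)

theorem d_time_apply_euler (htime : ∀ Q α, 𝒥.d .time (𝒟 Q α) = 𝒟 (fun β => 𝒥.d .time (Q β)) α)
    (F : B) (α : Fin q) : 𝒥.d .time (𝒟 (𝒥.euler F) α) = 𝒟 (𝒥.euler (𝒥.d .time F)) α := by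
  simp only [htime, d_time_euler]

theorem IsHamiltonian.Dt_sub_pr (h𝒟 : 𝒥.IsHamiltonian 𝒟)
    (htime : ∀ Q α, 𝒥.d .time (𝒟 Q α) = 𝒟 (fun β => 𝒥.d .time (Q β)) α) (P H : B) (ν : Fin q) :
    𝒥.Dt (𝒟 (𝒥.euler H)) (𝒟 (𝒥.euler P) ν) - 𝒥.pr (𝒟 (𝒥.euler P)) (𝒟 (𝒥.euler H) ν) =
      𝒟 (𝒥.euler (𝒥.d .time P + 𝒥.bracket 𝒟 P H)) ν := by
  rw [map_add, map_add, Pi.add_apply, ← h𝒟.pr_comm, ← d_time_apply_euler htime, Dt,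
    Derivation.add_apply, add_sub_assoc]

variable (𝒥) in
/-- A model of the ideal of the functions that vanish at a fixed initial time: a function is
determined in it by its time derivative, which may be prescribed. -/
structure InitialIdeal where
  ideal : Ideal B
  d_mem : ∀ c f, c ≠ .time → f ∈ ideal → 𝒥.d c f ∈ ideal
  eq_zero_of_d_time_eq_zero : ∀ f ∈ ideal, 𝒥.d .time f = 0 → f = 0
  exists_primitive : ∀ f, ∃ g ∈ ideal, 𝒥.d .time g = f

namespace InitialIdeal

variable (I : 𝒥.InitialIdeal)

theorem D_mem (i : Fin p) {f : B} (hf : f ∈ I.ideal) : 𝒥.D i f ∈ I.ideal :=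
  add_mem (I.d_mem _ f (by simp) hf) <| finsum_induction (· ∈ I.ideal) (zero_mem _)
    (fun _ _ => add_mem) fun _ => Ideal.mul_mem_left _ _ (I.d_mem _ f (by simp) hf)

theorem DJ_mem (J : MultiIndex p) {f : B} (hf : f ∈ I.ideal) : 𝒥.DJ J f ∈ I.ideal := by
  induction J using MultiIndex.induction_add_single with
  | zero => rwa [DJ_zero]
  | add_single J i ih => exact 𝒥.DJ_add_single J i f ▸ I.D_mem i ih

theorem euler_mem {f : B} (hf : f ∈ I.ideal) (α : Fin q) : 𝒥.euler f α ∈ I.ideal :=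
  finsum_induction (· ∈ I.ideal) (zero_mem _) (fun _ _ => add_mem) fun J =>
    Submodule.smul_of_tower_mem _ _ (I.DJ_mem J (I.d_mem _ f (by simp) hf))

/-- The primitive in time of a density `F` with `𝒟 δF = 0` is distinguished, since the time
derivative of `𝒟 δG` vanishes and so does its initial value. -/
theorem exists_distinguished_primitive
    (htime : ∀ Q α, 𝒥.d .time (𝒟 Q α) = 𝒟 (fun β => 𝒥.d .time (Q β)) α)
    (hinit : ∀ Q, (∀ β, Q β ∈ I.ideal) → ∀ α, 𝒟 Q α ∈ I.ideal) {F : B}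
    (hF : 𝒟 (𝒥.euler F) = 0) : ∃ G, 𝒟 (𝒥.euler G) = 0 ∧ 𝒥.d .time G = F := by
  obtain ⟨G, hG, hGF⟩ := I.exists_primitive F
  refine ⟨G, funext fun α => I.eq_zero_of_d_time_eq_zero _ (hinit _ (I.euler_mem hG) α) ?_, hGF⟩
  rw [d_time_apply_euler htime, hGF, hF, Pi.zero_apply]

end InitialIdeal

theorem IsHamiltonian.noether (h𝒟 : 𝒥.IsHamiltonian 𝒟) (I : 𝒥.InitialIdeal)
    (htime : ∀ Q α, 𝒥.d .time (𝒟 Q α) = 𝒟 (fun β => 𝒥.d .time (Q β)) α)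
    (hinit : ∀ Q, (∀ β, Q β ∈ I.ideal) → ∀ α, 𝒟 Q α ∈ I.ideal) (H P : B) :
    (∀ ν, 𝒥.Dt (𝒟 (𝒥.euler H)) (𝒟 (𝒥.euler P) ν) -
        𝒥.pr (𝒟 (𝒥.euler P)) (𝒟 (𝒥.euler H) ν) = 0) ↔
      ∃ G P', 𝒟 (𝒥.euler G) = 0 ∧ P' ≡ P - G [SMOD 𝒥.divRange] ∧
        𝒥.Dt (𝒟 (𝒥.euler H)) P' ≡ 0 [SMOD 𝒥.divRange] := by
  have hDt_sub {G : B} (hG : 𝒟 (𝒥.euler G) = 0) :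
      𝒥.Dt (𝒟 (𝒥.euler H)) (P - G) ≡
        𝒥.d .time P + 𝒥.bracket 𝒟 P H - 𝒥.d .time G [SMOD 𝒥.divRange] := by
    rw [map_sub, ← add_zero (𝒥.d .time G)]
    exact (Dt_smodEq_bracket P H).sub (.add .rfl (h𝒟.pr_smodEq_zero_of_distinguished hG H))
  simp only [h𝒟.Dt_sub_pr htime]
  constructor
  · intro hsymm
    obtain ⟨G, hG, hGt⟩ := I.exists_distinguished_primitive htime hinit (funext hsymm)
    exact ⟨G, P - G, hG, .rfl, sub_self (𝒥.d .time G) ▸ hGt ▸ hDt_sub hG⟩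
  · rintro ⟨G, P', hG, hP', hDt⟩ ν
    have hdefect : 𝒥.d .time P + 𝒥.bracket 𝒟 P H - 𝒥.d .time G ≡ 0 [SMOD 𝒥.divRange] :=
      (hDt_sub hG).symm.trans ((𝒥.Dt_smodEq _ hP').symm.trans hDt)
    rw [𝒥.euler_eq_of_smodEq (sub_smodEq_zero.1 hdefect), ← d_time_apply_euler htime, hG,
      Pi.zero_apply, map_zero]

end JetAlgebra

/-! ### Smoothness of parametric integrals -/

theorem continuousOn_intervalIntegral {E F : Type*} [TopologicalSpace E]
    [FirstCountableTopology E] [NormedAddCommGroup F] [NormedSpace ℝ F] {a b : ℝ} (hab : a ≤ b)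
    {h : ℝ × E → F} {V : Set E} (hh : ContinuousOn h (Set.Icc a b ×ˢ V)) :
    ContinuousOn (fun y => ∫ s in a..b, h (s, y)) V := by
  have hcont : Continuous fun x : V × ℝ => h (Set.projIcc a b hab x.2, x.1) :=
    hh.comp_continuous (by fun_prop) fun x => ⟨Subtype.coe_prop _, x.1.2⟩
  refine continuousOn_iff_continuous_domRestrict.2 <|
    (intervalIntegral.continuous_parametric_intervalIntegral_of_continuous'
      (f := fun (y : V) s => h (Set.projIcc a b hab s, y)) hcont a b).congr fun y =>
        intervalIntegral.integral_congr fun s hs => ?_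
  rw [Set.uIcc_of_le hab] at hs
  simp only [Set.projIcc_of_mem hab hs]

theorem hasFDerivAt_intervalIntegral {E F : Type*} [NormedAddCommGroup E] [NormedSpace ℝ E]
    [LocallyCompactSpace E] [NormedAddCommGroup F] [NormedSpace ℝ F] {a b : ℝ} (hab : a ≤ b)
    {h : ℝ × E → F} {h' : ℝ × E → E →L[ℝ] F} {V : Set E} (hV : IsOpen V)
    (hh : ContinuousOn h (Set.Icc a b ×ˢ V)) (hh' : ContinuousOn h' (Set.Icc a b ×ˢ V))
    (hderiv : ∀ s ∈ Set.Icc a b, ∀ y ∈ V, HasFDerivAt (fun y => h (s, y)) (h' (s, y)) y)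
    {y₀ : E} (hy₀ : y₀ ∈ V) :
    HasFDerivAt (fun y => ∫ s in a..b, h (s, y)) (∫ s in a..b, h' (s, y₀)) y₀ := by
  obtain ⟨K, hK, hKV, hKc⟩ := local_compact_nhds (hV.mem_nhds hy₀)
  obtain ⟨C, hC⟩ := (isCompact_Icc.prod hKc).exists_bound_of_continuousOn
    (hh'.mono (Set.prod_mono_right hKV))
  have hIoc : ∀ s ∈ Set.uIoc a b, s ∈ Set.Icc a b := fun s hs =>
    Set.Ioc_subset_Icc_self (Set.uIoc_of_le hab ▸ hs)
  have hslice (y) (hy : y ∈ V) : ContinuousOn (fun s => h (s, y)) (Set.Icc a b) :=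
    hh.comp (by fun_prop) fun s hs => ⟨hs, hy⟩
  have hslice' : ContinuousOn (fun s => h' (s, y₀)) (Set.Icc a b) :=
    hh'.comp (by fun_prop) fun s hs => ⟨hs, hy₀⟩
  refine intervalIntegral.hasFDerivAt_integral_of_dominated_of_fderiv_le
    (F := fun y s => h (s, y)) (F' := fun y s => h' (s, y)) (bound := fun _ => C) hK
    ?_ ?_ ?_ (.of_forall fun s hs y hy => hC (s, y) ⟨hIoc s hs, hy⟩) intervalIntegrable_const
    (.of_forall fun s hs y hy => hderiv s (hIoc s hs) y (hKV hy))
  · filter_upwards [hV.mem_nhds hy₀] with y hy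
    exact ((hslice y hy).mono hIoc).aestronglyMeasurable measurableSet_uIoc
  · exact (hslice y₀ hy₀).intervalIntegrable_of_Icc hab
  · exact (hslice'.mono hIoc).aestronglyMeasurable measurableSet_uIoc

theorem contDiffOn_intervalIntegral.{u} {E F : Type u} [NormedAddCommGroup E] [NormedSpace ℝ E]
    [LocallyCompactSpace E] [NormedAddCommGroup F] [NormedSpace ℝ F] {a b : ℝ} (hab : a ≤ b)
    {h : ℝ × E → F} {W : Set (ℝ × E)} {V : Set E} (hW : IsOpen W) (hV : IsOpen V)
    (hVW : Set.Icc a b ×ˢ V ⊆ W) {n : ℕ} (hh : ContDiffOn ℝ n h W) :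
    ContDiffOn ℝ n (fun y => ∫ s in a..b, h (s, y)) V := by
  induction n generalizing F with
  | zero =>
    rw [Nat.cast_zero, contDiffOn_zero] at hh ⊢
    exact continuousOn_intervalIntegral hab (hh.mono hVW)
  | succ n ih =>
    set h' : ℝ × E → E →L[ℝ] F := fun x => (fderiv ℝ h x).comp (.inr ℝ ℝ E)
    have hh' : ContDiffOn ℝ n h' W :=
      (hh.fderiv_of_isOpen hW (by norm_cast)).clm_comp contDiffOn_const
    have hderiv (y) (hy : y ∈ V) : HasFDerivAt (fun y => ∫ s in a..b, h (s, y))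
        (∫ s in a..b, h' (s, y)) y := by
      refine hasFDerivAt_intervalIntegral hab hV (hh.continuousOn.mono hVW)
        (hh'.continuousOn.mono hVW) (fun s hs y hy => ?_) hy
      exact ((hh.differentiableOn (by simp)).differentiableAt
        (hW.mem_nhds (hVW ⟨hs, hy⟩))).hasFDerivAt.comp y (hasFDerivAt_prodMk_right s y)
    rw [Nat.cast_succ, contDiffOn_succ_iff_fderiv_of_isOpen hV]
    exact ⟨fun y hy => (hderiv y hy).differentiableAt.differentiableWithinAt, by simp,
      (ih hh').congr fun y hy => (hderiv y hy).fderiv⟩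

/-- The substitution `θ = r + s (y τ - r)` turns the variable bound into a fixed one. -/
theorem contDiffOn_integral_update {ι : Type} [Fintype ι] [DecidableEq ι] {V : Set (ι → ℝ)}
    (hV : IsOpen V) {f : (ι → ℝ) → ℝ} (hf : ContDiffOn ℝ ∞ f V) {τ : ι} {r : ℝ}
    (hr : ∀ y ∈ V, ∀ θ ∈ Set.uIcc r (y τ), Function.update y τ θ ∈ V) :
    ContDiffOn ℝ ∞ (fun y => ∫ θ in r..y τ, f (Function.update y τ θ)) V := by
  let φ : ℝ × (ι → ℝ) → ι → ℝ := fun x => Function.update x.2 τ (r + (x.2 τ - r) * x.1)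
  have hφ : ContDiff ℝ ∞ φ := by
    refine contDiff_pi.2 fun e => ?_
    obtain rfl | he := eq_or_ne e τ
    · simp only [φ, Function.update_self]
      fun_prop
    · simp only [φ, Function.update_of_ne he]
      fun_prop
  have hφV : Set.Icc 0 1 ×ˢ V ⊆ φ ⁻¹' V := fun x hx => by
    refine hr x.2 hx.2 _ (segment_eq_uIcc r (x.2 τ) ▸ ?_)
    exact segment_eq_image' ℝ r (x.2 τ) ▸ ⟨x.1, hx.1, by simp [mul_comm]⟩
  have hint : ContDiffOn ℝ ∞ (fun y => ∫ s in (0 : ℝ)..1, f (φ (s, y))) V :=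
    contDiffOn_infty.2 fun n => contDiffOn_intervalIntegral (h := f ∘ φ) zero_le_one
      (hV.preimage hφ.continuous) hV hφV
      (contDiffOn_infty.1 (hf.comp hφ.contDiffOn fun _ hx => hx) n)
  have hcoord : ContDiffOn ℝ ∞ (fun y : ι → ℝ => y τ - r) V := by fun_prop
  refine (hcoord.mul hint).congr fun y _ => ?_
  simpa using (intervalIntegral.mul_integral_comp_add_mul (a := 0) (b := 1)
    (f := fun θ => f (Function.update y τ θ)) (y τ - r) r).symm

/-! ### Orders of vanishing -/

theorem isLittleO_sub_taylor {E : Type*} [NormedAddCommGroup E] [NormedSpace ℝ E] {g : ℝ → E}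
    {x₀ : ℝ} {n : ℕ} (hg : ContDiffAt ℝ n g x₀) :
    (fun x => g x - ∑ i ∈ Finset.range (n + 1),
      ((i.factorial : ℝ)⁻¹ * (x - x₀) ^ i) • iteratedDeriv i g x₀) =o[𝓝 x₀]
        fun x => (x - x₀) ^ n := by
  obtain ⟨s, hs, hgs⟩ := hg.contDiffOn le_rfl (by simp)
  obtain ⟨r, hr, hrs⟩ := Metric.mem_nhds_iff.1 hs
  have hx₀ : x₀ ∈ Metric.ball x₀ r := Metric.mem_ball_self hr
  have h := taylor_isLittleO (convex_ball x₀ r) hx₀ (hgs.mono hrs)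
  rw [Metric.isOpen_ball.nhdsWithin_eq hx₀] at h
  simpa only [taylor_within_apply, iteratedDerivWithin_of_isOpen Metric.isOpen_ball hx₀] using h

theorem eq_zero_of_pow_smul_isLittleO {E : Type*} [NormedAddCommGroup E] [NormedSpace ℝ E]
    {x₀ : ℝ} {n : ℕ} {c : E} (h : (fun x => (x - x₀) ^ n • c) =o[𝓝 x₀] fun x => (x - x₀) ^ n) :
    c = 0 := by
  by_contra hc
  have hpow : ∃ᶠ x in 𝓝 x₀, (x - x₀) ^ n ≠ 0 := by
    refine (Filter.Eventually.frequently ?_).filter_mono (nhdsWithin_le_nhds (s := {x₀}ᶜ))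
    filter_upwards [self_mem_nhdsWithin] with x hx using pow_ne_zero n (sub_ne_zero.2 hx)
  refine Asymptotics.isLittleO_irrefl (E'' := ℝ) hpow (.of_norm_left ?_)
  refine (Asymptotics.isLittleO_const_mul_left_iff (norm_ne_zero_iff.2 hc)).1 ?_
  simpa only [norm_smul, mul_comm] using h.norm_left

theorem isLittleO_pow_iff_iteratedDeriv_eq_zero {E : Type*} [NormedAddCommGroup E]
    [NormedSpace ℝ E] {g : ℝ → E} {x₀ : ℝ} {n : ℕ} (hg : ContDiffAt ℝ n g x₀) :
    (g =o[𝓝 x₀] fun x => (x - x₀) ^ n) ↔ ∀ j ≤ n, iteratedDeriv j g x₀ = 0 := by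
  refine ⟨fun h j hj => ?_, fun h => ?_⟩
  · induction j using Nat.strong_induction_on with
    | _ j ih =>
      have hpow : (fun x => (x - x₀) ^ n) =O[𝓝 x₀] fun x => (x - x₀) ^ j := by
        have hbdd : (fun x : ℝ => (x - x₀) ^ (n - j)) =O[𝓝 x₀] fun _ => (1 : ℝ) :=
          ((Continuous.tendsto (by fun_prop) x₀).isBigO_one ℝ)
        simpa only [← pow_add, Nat.add_sub_cancel' hj, mul_one] using
          (Asymptotics.isBigO_refl (fun x => (x - x₀) ^ j) _).mul hbdd
      have hlead := eq_zero_of_pow_smul_isLittleO (n := j)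
        (c := (j.factorial : ℝ)⁻¹ • iteratedDeriv j g x₀)
        (((h.trans_isBigO hpow).sub
          (isLittleO_sub_taylor (hg.of_le (by exact_mod_cast hj)))).congr_left fun x => ?_)
      · exact (smul_eq_zero_iff_right (by positivity)).1 hlead
      · rw [sub_sub_cancel, Finset.sum_range_succ, Finset.sum_eq_zero, zero_add, mul_comm,
          mul_smul]
        intro i hi
        have hij := Finset.mem_range.1 hi
        rw [ih i hij (hij.le.trans hj), smul_zero]
  · refine (isLittleO_sub_taylor hg).congr_left fun x => ?_
    rw [Finset.sum_eq_zero, sub_zero]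
    exact fun i hi => by rw [h i (Finset.mem_range_succ_iff.1 hi), smul_zero]

/-! ### Differential functions -/

section differentialFunctions

variable {p q : ℕ} {Ω : Domain p q}

theorem Domain.isOpen_carrier (Ω : Domain p q) : IsOpen Ω.carrier :=
  (Ω.isOpen_T.preimage (continuous_apply _)).inter <|
    (Ω.isOpen_M.preimage (.prodMk (continuous_pi fun _ => continuous_apply _)
      (continuous_pi fun _ => continuous_apply _))).inter <|
        isOpen_lt (continuous_apply _).abs continuous_const

theorem continuous_update (z : JetPoint p q) (c : Coord p q) :
    Continuous fun s : ℝ => Function.update z c s :=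
  continuous_const.update c continuous_id

theorem Domain.eventually_update_mem (Ω : Domain p q) {z : JetPoint p q} (hz : z ∈ Ω.carrier)
    (c : Coord p q) : ∀ᶠ s in 𝓝 (z c), Function.update z c s ∈ Ω.carrier := by
  refine (continuous_update z c).continuousAt.eventually_mem (Ω.isOpen_carrier.mem_nhds ?_)
  rwa [Function.update_eq_self]

theorem Domain.update_time_mem (Ω : Domain p q) {z : JetPoint p q} (hz : z ∈ Ω.carrier) {t : ℝ}
    (ht : t ∈ Ω.T) : Function.update z .time t ∈ Ω.carrier := by
  refine ⟨by simpa using ht, ?_, by simpa using hz.2.2⟩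
  simpa using hz.2.1

theorem Domain.update_eps_mem (Ω : Domain p q) {z : JetPoint p q} (hz : z ∈ Ω.carrier) {ε : ℝ}
    (hε : |ε| < Ω.eps0) : Function.update z .eps ε ∈ Ω.carrier := by
  refine ⟨by simpa using hz.1, ?_, by simpa using hε⟩
  simpa using hz.2.1

theorem Domain.eventually_update_eps_mem (Ω : Domain p q) {z : JetPoint p q}
    (hz : z ∈ Ω.carrier) : ∀ᶠ ε in 𝓝 (0 : ℝ), Function.update z .eps ε ∈ Ω.carrier := by
  filter_upwards [Metric.ball_mem_nhds (0 : ℝ) Ω.eps0_pos] with ε hε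
  exact Ω.update_eps_mem hz (by simpa using hε)

theorem Domain.ordConnected_T (Ω : Domain p q) : Ω.T.OrdConnected :=
  Ω.isConnected_T.isPreconnected.ordConnected

/-- The projection to finitely many coordinates. -/
def proj (S : Finset (Coord p q)) (z : JetPoint p q) : S → ℝ := fun c => z c

theorem proj_update_of_mem {S : Finset (Coord p q)} {c : Coord p q} (hc : c ∈ S)
    (z : JetPoint p q) (s : ℝ) :
    proj S (Function.update z c s) = Function.update (proj S z) ⟨c, hc⟩ s := by
  ext e
  by_cases h : e = ⟨c, hc⟩
  · subst h
    simp [proj]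
  · have : (e : Coord p q) ≠ c := fun h' => h (Subtype.ext h')
    simp [proj, h, this]

theorem proj_update_of_notMem {S : Finset (Coord p q)} {c : Coord p q} (hc : c ∉ S)
    (z : JetPoint p q) (s : ℝ) : proj S (Function.update z c s) = proj S z := by
  ext e
  have : (e : Coord p q) ≠ c := fun h' => hc (h' ▸ e.2)
  simp [proj, this]

theorem isOpen_proj (Ω : Domain p q) (S : Finset (Coord p q)) :
    IsOpen (proj S '' Ω.carrier) := by
  rw [isOpen_iff_mem_nhds]
  rintro _ ⟨z, hz, rfl⟩
  let glue : (S → ℝ) → JetPoint p q := fun y c => if h : c ∈ S then y ⟨c, h⟩ else z c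
  have hglue : Continuous glue := by
    refine continuous_pi fun c => ?_
    by_cases h : c ∈ S
    · simpa only [glue, dif_pos h] using continuous_apply _
    · simpa only [glue, dif_neg h] using continuous_const
  have hz' : glue (proj S z) = z := by
    ext c
    by_cases h : c ∈ S <;> simp [glue, proj, h]
  filter_upwards [hglue.continuousAt.eventually_mem
    (Ω.isOpen_carrier.mem_nhds (by rwa [hz']))] with y hy
  refine ⟨_, hy, ?_⟩
  ext c
  simp [glue, proj]

/-- `f` represents `F` smoothly in terms of the coordinates in `S`. -/
def IsChart (Ω : Domain p q) (S : Finset (Coord p q)) (f : (S → ℝ) → ℝ) (F : JetFun p q) : Prop :=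
  ContDiffOn ℝ ∞ f (proj S '' Ω.carrier) ∧ ∀ z ∈ Ω.carrier, F z = f (proj S z)

theorem IsChart.mono {S S' : Finset (Coord p q)} {f : (S → ℝ) → ℝ} {F : JetFun p q}
    (h : IsChart Ω S f F) (hS : S ⊆ S') :
    IsChart Ω S' (fun y => f fun c => y ⟨c, hS c.2⟩) F := by
  refine ⟨h.1.comp (g := f) (f := fun (y : S' → ℝ) (c : S) => y ⟨c, hS c.2⟩) (by fun_prop) ?_,
    fun z hz => h.2 z hz⟩
  rintro _ ⟨z, hz, rfl⟩
  exact ⟨z, hz, rfl⟩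

theorem IsDiffFun.exists_chart {F : JetFun p q} (h : IsDiffFun Ω F) (S : Finset (Coord p q)) :
    ∃ S' f, S ⊆ S' ∧ IsChart Ω S' f F := by
  obtain ⟨T, f, hf⟩ := h
  exact ⟨S ∪ T, _, Finset.subset_union_left, IsChart.mono hf Finset.subset_union_right⟩

theorem IsDiffFun.exists_chart₂ {F G : JetFun p q} (hF : IsDiffFun Ω F) (hG : IsDiffFun Ω G) :
    ∃ S f g, IsChart Ω S f F ∧ IsChart Ω S g G := by
  obtain ⟨T, f, hf⟩ := hF
  obtain ⟨S, g, hS, hg⟩ := hG.exists_chart T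
  exact ⟨S, _, g, IsChart.mono hf hS, hg⟩

theorem IsDiffFun.congr {F G : JetFun p q} (hF : IsDiffFun Ω F)
    (h : ∀ z ∈ Ω.carrier, G z = F z) : IsDiffFun Ω G := by
  obtain ⟨S, f, hf⟩ := hF
  exact ⟨S, f, hf.1, fun z hz => (h z hz).trans (hf.2 z hz)⟩

theorem IsDiffFun.const (r : ℝ) : IsDiffFun Ω fun _ => r :=
  ⟨∅, fun _ => r, contDiffOn_const, fun _ _ => rfl⟩

theorem IsDiffFun.coord (c : Coord p q) : IsDiffFun Ω fun z => z c :=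
  ⟨{c}, fun y => y ⟨c, by simp⟩, by fun_prop, fun _ _ => rfl⟩

theorem IsDiffFun.add {F G : JetFun p q} (hF : IsDiffFun Ω F) (hG : IsDiffFun Ω G) :
    IsDiffFun Ω (F + G) := by
  obtain ⟨S, f, g, hf, hg⟩ := hF.exists_chart₂ hG
  exact ⟨S, fun y => f y + g y, hf.1.add hg.1, fun z hz => congrArg₂ _ (hf.2 z hz) (hg.2 z hz)⟩

theorem IsDiffFun.mul {F G : JetFun p q} (hF : IsDiffFun Ω F) (hG : IsDiffFun Ω G) :
    IsDiffFun Ω (F * G) := by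
  obtain ⟨S, f, g, hf, hg⟩ := hF.exists_chart₂ hG
  exact ⟨S, fun y => f y * g y, hf.1.mul hg.1, fun z hz => congrArg₂ _ (hf.2 z hz) (hg.2 z hz)⟩

theorem IsChart.hasDerivAt_of_mem {S : Finset (Coord p q)} {f : (S → ℝ) → ℝ} {F : JetFun p q}
    (h : IsChart Ω S f F) {c : Coord p q} (hc : c ∈ S) {z : JetPoint p q} (hz : z ∈ Ω.carrier) :
    HasDerivAt (fun s => F (Function.update z c s))
      (fderiv ℝ f (proj S z) (Pi.single ⟨c, hc⟩ 1)) (z c) := by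
  have h1 : HasFDerivAt f (fderiv ℝ f (proj S z))
      (Function.update (proj S z) ⟨c, hc⟩ (z c)) := by
    have : Function.update (proj S z) ⟨c, hc⟩ (z c) = proj S z :=
      Function.update_eq_self (⟨c, hc⟩ : S) (proj S z)
    rw [this]
    exact ((h.1.differentiableOn (by simp)).differentiableAt
      ((isOpen_proj Ω S).mem_nhds ⟨z, hz, rfl⟩)).hasFDerivAt
  have h2 := h1.comp_hasDerivAt _ (hasDerivAt_update (proj S z) ⟨c, hc⟩ (z c))
  refine h2.congr_of_eventuallyEq ?_
  filter_upwards [Ω.eventually_update_mem hz c] with s hs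
  rw [h.2 _ hs, proj_update_of_mem hc]
  rfl

theorem IsChart.hasDerivAt_of_notMem {S : Finset (Coord p q)} {f : (S → ℝ) → ℝ}
    {F : JetFun p q} (h : IsChart Ω S f F) {c : Coord p q} (hc : c ∉ S) {z : JetPoint p q}
    (hz : z ∈ Ω.carrier) : HasDerivAt (fun s => F (Function.update z c s)) 0 (z c) := by
  refine (hasDerivAt_const (z c) (F z)).congr_of_eventuallyEq ?_
  filter_upwards [Ω.eventually_update_mem hz c] with s hs
  rw [h.2 _ hs, proj_update_of_notMem hc, h.2 _ hz]

theorem IsDiffFun.hasDerivAt {F : JetFun p q} (h : IsDiffFun Ω F) (c : Coord p q)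
    {z : JetPoint p q} (hz : z ∈ Ω.carrier) :
    HasDerivAt (fun s => F (Function.update z c s)) (pd c F z) (z c) := by
  obtain ⟨S, f, hS, hf⟩ := h.exists_chart {c}
  exact (hf.hasDerivAt_of_mem (by simpa using hS) hz).differentiableAt.hasDerivAt

theorem IsDiffFun.hasDerivAt_update {F : JetFun p q} (h : IsDiffFun Ω F) (c : Coord p q)
    {z : JetPoint p q} {s : ℝ} (hz : Function.update z c s ∈ Ω.carrier) :
    HasDerivAt (fun s => F (Function.update z c s)) (pd c F (Function.update z c s)) s := by
  simpa using h.hasDerivAt c hz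

protected theorem IsChart.pd {S : Finset (Coord p q)} {f : (S → ℝ) → ℝ} {F : JetFun p q}
    (h : IsChart Ω S f F) {c : Coord p q} (hc : c ∈ S) :
    IsChart Ω S (fun y => fderiv ℝ f y (Pi.single ⟨c, hc⟩ 1)) (pd c F) :=
  ⟨(h.1.fderiv_of_isOpen (isOpen_proj Ω S) (by simp)).clm_apply contDiffOn_const,
    fun _ hz => (h.hasDerivAt_of_mem hc hz).deriv⟩

protected theorem IsDiffFun.pd {F : JetFun p q} (h : IsDiffFun Ω F) (c : Coord p q) :
    IsDiffFun Ω (pd c F) := by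
  obtain ⟨S, f, hS, hf⟩ := h.exists_chart {c}
  exact ⟨S, _, hf.pd (by simpa using hS)⟩

theorem IsDiffFun.pd_iterate {F : JetFun p q} (h : IsDiffFun Ω F) (c : Coord p q) (n : ℕ) :
    IsDiffFun Ω ((pd c)^[n] F) := by
  induction n with
  | zero => exact h
  | succ n ih =>
    rw [Function.iterate_succ_apply']
    exact ih.pd c

theorem pd_congr {F G : JetFun p q} (h : ∀ z ∈ Ω.carrier, F z = G z) (c : Coord p q) :
    ∀ z ∈ Ω.carrier, pd c F z = pd c G z := by
  intro z hz
  apply Filter.EventuallyEq.deriv_eq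
  filter_upwards [Ω.eventually_update_mem hz c] with s hs using h _ hs

theorem IsDiffFun.finite_support {F : JetFun p q} (h : IsDiffFun Ω F) :
    {c | ∃ z ∈ Ω.carrier, pd c F z ≠ 0}.Finite := by
  obtain ⟨S, f, hf⟩ := h
  refine S.finite_toSet.subset fun c ⟨z, hz, hne⟩ => ?_
  by_contra hc
  exact hne (IsChart.hasDerivAt_of_notMem hf hc hz).deriv

theorem IsDiffFun.finite_support_jet {F : JetFun p q} (h : IsDiffFun Ω F) (α : Fin q) :
    {J | ∃ z ∈ Ω.carrier, pd (.jet α J) F z ≠ 0}.Finite :=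
  h.finite_support.preimage (f := Coord.jet α) (Set.injOn_of_injective fun _ _ hJ =>
    (Coord.jet.inj hJ).2)

theorem pd_add {F G : JetFun p q} (hF : IsDiffFun Ω F) (hG : IsDiffFun Ω G) (c : Coord p q)
    {z : JetPoint p q} (hz : z ∈ Ω.carrier) : pd c (F + G) z = pd c F z + pd c G z :=
  ((hF.hasDerivAt c hz).add (hG.hasDerivAt c hz)).deriv

theorem pd_mul {F G : JetFun p q} (hF : IsDiffFun Ω F) (hG : IsDiffFun Ω G) (c : Coord p q)
    {z : JetPoint p q} (hz : z ∈ Ω.carrier) :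
    pd c (F * G) z = F z * pd c G z + G z * pd c F z := by
  have := ((hF.hasDerivAt c hz).mul (hG.hasDerivAt c hz)).deriv
  simp only [Function.update_eq_self] at this
  refine this.trans ?_
  ring

theorem pd_const (c : Coord p q) (r : ℝ) (z : JetPoint p q) : pd c (fun _ => r) z = 0 :=
  deriv_const _ _

theorem pd_coord (c e : Coord p q) (z : JetPoint p q) :
    pd c (fun z => z e) z = if c = e then 1 else 0 := by
  by_cases h : c = e
  · subst h
    simp [pd]
  · simp [pd, h, Ne.symm h]

theorem pd_comm {F : JetFun p q} (hF : IsDiffFun Ω F) (c e : Coord p q) {z : JetPoint p q}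
    (hz : z ∈ Ω.carrier) : pd c (pd e F) z = pd e (pd c F) z := by
  obtain ⟨S, f, hS, hf⟩ := hF.exists_chart {c, e}
  have hc : c ∈ S := hS (by simp)
  have he : e ∈ S := hS (by simp)
  have hmem := (isOpen_proj Ω S).mem_nhds ⟨z, hz, rfl⟩
  have hd : DifferentiableAt ℝ (fderiv ℝ f) (proj S z) :=
    ((hf.1.fderiv_of_isOpen (m := ∞) (isOpen_proj Ω S) (by simp)).differentiableOn
      (by simp)).differentiableAt hmem
  have key : ∀ {c e : Coord p q} (hc : c ∈ S) (he : e ∈ S), pd c (pd e F) z =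
      fderiv ℝ (fderiv ℝ f) (proj S z) (Pi.single ⟨c, hc⟩ 1) (Pi.single ⟨e, he⟩ 1) := by
    intro c e hc he
    rw [((hf.pd he).pd hc).2 z hz]
    change fderiv ℝ (fun y => fderiv ℝ f y (Pi.single ⟨e, he⟩ 1)) (proj S z) _ = _
    rw [fderiv_clm_apply hd (differentiableAt_const _)]
    simp
  rw [key hc he, key he hc]
  refine (hf.1.contDiffAt hmem).isSymmSndFDerivAt ?_ _ _
  exact minSmoothness_of_isRCLikeNormedField.trans_le (WithTop.coe_le_coe.2 le_top)

theorem pd_eps_iterate_comm {F : JetFun p q} (hF : IsDiffFun Ω F) (c : Coord p q) (n : ℕ) :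
    ∀ z ∈ Ω.carrier, (pd .eps)^[n] (pd c F) z = pd c ((pd .eps)^[n] F) z := by
  induction n with
  | zero => intro z _; rfl
  | succ n ih =>
    intro z hz
    rw [Function.iterate_succ_apply', Function.iterate_succ_apply',
      pd_congr ih .eps z hz, pd_comm (hF.pd_iterate _ n) _ _ hz]

theorem pd_eq_zero_of_slice {F : JetFun p q} {c e : Coord p q} (hce : c ≠ e) {r : ℝ}
    (h : ∀ z ∈ Ω.carrier, z e = r → F z = 0) {z : JetPoint p q} (hz : z ∈ Ω.carrier)
    (hr : z e = r) : pd c F z = 0 := by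
  have : (fun s => F (Function.update z c s)) =ᶠ[𝓝 (z c)] fun _ => 0 := by
    filter_upwards [Ω.eventually_update_mem hz c] with s hs
    exact h _ hs (by rw [Function.update_of_ne hce.symm, hr])
  rw [pd, this.deriv_eq, deriv_const]

/-! ### Approximate equality -/

theorem IsDiffFun.contDiffAt_eps {F : JetFun p q} (hF : IsDiffFun Ω F) {z : JetPoint p q}
    (hz : z ∈ Ω.carrier) : ContDiffAt ℝ ∞ (fun ε => F (Function.update z .eps ε)) 0 := by
  obtain ⟨S, f, hS, hf⟩ := hF.exists_chart {.eps}
  have hc : Coord.eps ∈ S := by simpa using hS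
  have h0 : Function.update z .eps 0 ∈ Ω.carrier :=
    Ω.update_eps_mem hz (by simpa using Ω.eps0_pos)
  have h1 : ContDiffAt ℝ ∞ f (Function.update (proj S z) ⟨.eps, hc⟩ 0) := by
    rw [← proj_update_of_mem hc]
    exact hf.1.contDiffAt ((isOpen_proj Ω S).mem_nhds ⟨_, h0, rfl⟩)
  refine (h1.comp (0 : ℝ) (contDiff_update _ _ _).contDiffAt).congr_of_eventuallyEq ?_
  filter_upwards [Ω.eventually_update_eps_mem hz] with ε hε
  rw [hf.2 _ hε, proj_update_of_mem hc]
  rfl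

theorem iteratedDeriv_eps (F : JetFun p q) (z : JetPoint p q) (n : ℕ) (ε : ℝ) :
    iteratedDeriv n (fun ε => F (Function.update z .eps ε)) ε =
      (pd .eps)^[n] F (Function.update z .eps ε) := by
  induction n generalizing ε with
  | zero => rfl
  | succ n ih =>
    rw [iteratedDeriv_succ, Function.iterate_succ_apply', funext ih]
    simp [pd]

theorem isLittleO_iff {F : JetFun p q} (hF : IsDiffFun Ω F) (k : ℕ) :
    IsLittleO Ω k F ↔ ∀ j ≤ k, ∀ z ∈ Ω.carrier, z .eps = 0 → (pd .eps)^[j] F z = 0 := by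
  have hz_iff (z) (hz : z ∈ Ω.carrier) :
      ((fun ε => F (Function.update z .eps ε)) =o[𝓝 0] fun ε => ε ^ k) ↔
        ∀ j ≤ k, (pd .eps)^[j] F (Function.update z .eps 0) = 0 := by
    have h := isLittleO_pow_iff_iteratedDeriv_eq_zero (n := k)
      ((hF.contDiffAt_eps hz).of_le (WithTop.coe_le_coe.2 le_top))
    simpa only [sub_zero, iteratedDeriv_eps] using h
  refine ⟨fun h j hj z hz h0 => ?_, fun h z hz => (hz_iff z hz).2 fun j hj => ?_⟩
  · simpa only [← h0, Function.update_eq_self] using (hz_iff z hz).1 (h z hz) j hj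
  · exact h j hj _ (Ω.update_eps_mem hz (by simpa using Ω.eps0_pos)) (Function.update_self ..)

theorem IsLittleO.add {k : ℕ} {F G : JetFun p q} (hF : IsLittleO Ω k F) (hG : IsLittleO Ω k G) :
    IsLittleO Ω k (F + G) :=
  fun z hz => (hF z hz).add (hG z hz)

theorem IsLittleO.mul_left {k : ℕ} {F G : JetFun p q} (hG : IsDiffFun Ω G)
    (hF : IsLittleO Ω k F) : IsLittleO Ω k (G * F) := by
  intro z hz
  have h1 := (hG.contDiffAt_eps hz).continuousAt.tendsto.isBigO_one ℝ
  simpa using h1.mul_isLittleO (hF z hz)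

theorem isLittleO_of_eq_zero {k : ℕ} {F : JetFun p q} (hF : ∀ z ∈ Ω.carrier, F z = 0) :
    IsLittleO Ω k F := by
  intro z hz
  refine (Asymptotics.isLittleO_zero _ _).congr' ?_ Filter.EventuallyEq.rfl
  filter_upwards [Ω.eventually_update_eps_mem hz] with ε hε using (hF _ hε).symm

protected theorem IsLittleO.pd {k : ℕ} {F : JetFun p q} (hF : IsDiffFun Ω F) (h : IsLittleO Ω k F)
    {c : Coord p q} (hc : c ≠ .eps) : IsLittleO Ω k (pd c F) := by
  rw [isLittleO_iff (hF.pd c)]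
  rw [isLittleO_iff hF] at h
  intro j hj z hz h0
  rw [pd_eps_iterate_comm hF c j z hz]
  exact pd_eq_zero_of_slice hc (h j hj) hz h0

theorem pd_eps_iterate_eq_zero_of_time_eq {F : JetFun p q} {t₀ : ℝ}
    (h : ∀ z ∈ Ω.carrier, z .time = t₀ → F z = 0) (j : ℕ) :
    ∀ z ∈ Ω.carrier, z .time = t₀ → (pd .eps)^[j] F z = 0 := by
  induction j with
  | zero => exact h
  | succ j ih =>
    intro z hz ht
    rw [Function.iterate_succ_apply']
    exact pd_eq_zero_of_slice (by simp) ih hz ht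

theorem IsDiffFun.update_time_eq {F : JetFun p q} (hF : IsDiffFun Ω F) {z : JetPoint p q}
    (hz : z ∈ Ω.carrier) (h : ∀ t ∈ Ω.T, pd .time F (Function.update z .time t) = 0) {t : ℝ}
    (ht : t ∈ Ω.T) : F (Function.update z .time t) = F z := by
  have hderiv (s) (hs : s ∈ Ω.T) :
      HasDerivAt (fun s => F (Function.update z .time s)) 0 s :=
    h s hs ▸ hF.hasDerivAt_update .time (Ω.update_time_mem hz hs)
  have hconst := Ω.isOpen_T.is_const_of_deriv_eq_zero Ω.isConnected_T.isPreconnected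
    (fun s hs => (hderiv s hs).differentiableAt.differentiableWithinAt)
    (fun s hs => (hderiv s hs).deriv) ht hz.1
  simpa only [Function.update_eq_self] using hconst

theorem isLittleO_of_pd_time {k : ℕ} {F : JetFun p q} (hF : IsDiffFun Ω F) {t₀ : ℝ}
    (ht₀ : t₀ ∈ Ω.T) (h0 : ∀ z ∈ Ω.carrier, z .time = t₀ → F z = 0)
    (h : IsLittleO Ω k (pd .time F)) : IsLittleO Ω k F := by
  rw [isLittleO_iff (hF.pd _)] at h
  refine (isLittleO_iff hF k).2 fun j hj z hz hε => ?_
  have hderiv (t) (ht : t ∈ Ω.T) : pd .time ((pd .eps)^[j] F) (Function.update z .time t) = 0 := by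
    have hm := Ω.update_time_mem hz ht
    rw [← pd_eps_iterate_comm hF _ _ _ hm]
    exact h j hj _ hm (by simpa using hε)
  rw [← (hF.pd_iterate .eps j).update_time_eq hz hderiv ht₀]
  exact pd_eps_iterate_eq_zero_of_time_eq h0 j _ (Ω.update_time_mem hz ht₀) (by simp)

/-- The primitive in time that vanishes at the time `t₀`. -/
def primitive (t₀ : ℝ) (F : JetFun p q) : JetFun p q :=
  fun z => ∫ θ in t₀..z .time, F (Function.update z .time θ)

protected theorem IsDiffFun.primitive {F : JetFun p q} (hF : IsDiffFun Ω F) {t₀ : ℝ}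
    (ht₀ : t₀ ∈ Ω.T) : IsDiffFun Ω (primitive t₀ F) := by
  obtain ⟨S, f, hS, hf⟩ := hF.exists_chart {.time}
  have hc : Coord.time ∈ S := by simpa using hS
  have hmem (z) (hz : z ∈ Ω.carrier) (θ) (hθ : θ ∈ Set.uIcc t₀ (z .time)) :
      Function.update z .time θ ∈ Ω.carrier :=
    Ω.update_time_mem hz (Ω.ordConnected_T.uIcc_subset ht₀ hz.1 hθ)
  refine ⟨S, _, contDiffOn_integral_update (isOpen_proj Ω S) hf.1 (τ := ⟨.time, hc⟩) (r := t₀) ?_,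
    fun z hz => intervalIntegral.integral_congr fun θ hθ => ?_⟩
  · rintro _ ⟨z, hz, rfl⟩ θ hθ
    exact ⟨_, hmem z hz θ hθ, proj_update_of_mem hc z θ⟩
  · exact (hf.2 _ (hmem z hz θ hθ)).trans (congrArg f (proj_update_of_mem hc z θ))

theorem pd_time_primitive {F : JetFun p q} (hF : IsDiffFun Ω F) {t₀ : ℝ} (ht₀ : t₀ ∈ Ω.T)
    {z : JetPoint p q} (hz : z ∈ Ω.carrier) : pd .time (primitive t₀ F) z = F z := by
  have hcont : ContinuousOn (fun θ => F (Function.update z .time θ)) Ω.T := fun t ht =>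
    (hF.hasDerivAt_update .time (Ω.update_time_mem hz ht)).continuousAt.continuousWithinAt
  have h := intervalIntegral.integral_hasDerivAt_right (a := t₀) (b := z .time)
    (f := fun θ => F (Function.update z .time θ))
    (hcont.mono (Ω.ordConnected_T.uIcc_subset ht₀ hz.1)).intervalIntegrable
    (hcont.stronglyMeasurableAtFilter Ω.isOpen_T _ hz.1)
    (hcont.continuousAt (Ω.isOpen_T.mem_nhds hz.1))
  rw [Function.update_eq_self] at h
  rw [← h.deriv, pd]
  simp [primitive]

theorem primitive_eq_zero (t₀ : ℝ) (F : JetFun p q) {z : JetPoint p q} (hz : z .time = t₀) :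
    primitive t₀ F z = 0 := by
  rw [primitive, hz, intervalIntegral.integral_same]

end differentialFunctions

/-! ### Differential functions up to approximate equality -/

section approxAlgebra

variable {p q : ℕ} {Ω : Domain p q} {k : ℕ}

/-- The algebra of differential functions. -/
def diffAlgebra (Ω : Domain p q) : Subalgebra ℝ (JetFun p q) where
  carrier := {F | IsDiffFun Ω F}
  mul_mem' := IsDiffFun.mul
  add_mem' := IsDiffFun.add
  algebraMap_mem' := IsDiffFun.const

/-- The ideal of differential functions that are `o(ε^k)`. -/
def littleOIdeal (Ω : Domain p q) (k : ℕ) : Ideal (diffAlgebra Ω) where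
  carrier := {F | IsLittleO Ω k F}
  zero_mem' := isLittleO_of_eq_zero fun _ _ => rfl
  add_mem' := IsLittleO.add
  smul_mem' G _ hF := IsLittleO.mul_left G.2 hF

/-- The algebra of differential functions modulo `o(ε^k)`, in which `≈` becomes equality. -/
def ApproxAlgebra (Ω : Domain p q) (k : ℕ) : Type := diffAlgebra Ω ⧸ littleOIdeal Ω k

instance : CommRing (ApproxAlgebra Ω k) :=
  inferInstanceAs (CommRing (diffAlgebra Ω ⧸ littleOIdeal Ω k))

instance : Algebra ℝ (ApproxAlgebra Ω k) :=
  inferInstanceAs (Algebra ℝ (diffAlgebra Ω ⧸ littleOIdeal Ω k))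

/-- The quotient map from differential functions to their classes modulo `o(ε^k)`. -/
def toApprox (Ω : Domain p q) (k : ℕ) : diffAlgebra Ω →ₐ[ℝ] ApproxAlgebra Ω k :=
  Ideal.Quotient.mkₐ ℝ (littleOIdeal Ω k)

/-- `F` is a differential function whose class is `b`. Working with this relation rather than with
`toApprox` keeps the functions of the statement, which are not bundled, free of coercions. -/
def Represents (F : JetFun p q) (b : ApproxAlgebra Ω k) : Prop :=
  ∃ h : IsDiffFun Ω F, toApprox Ω k ⟨F, h⟩ = b

theorem IsDiffFun.exists_represents (k : ℕ) {F : JetFun p q} (h : IsDiffFun Ω F) :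
    ∃ b : ApproxAlgebra Ω k, Represents F b :=
  ⟨_, h, rfl⟩

theorem exists_represents (b : ApproxAlgebra Ω k) : ∃ F, Represents F b := by
  obtain ⟨⟨F, h⟩, rfl⟩ := Ideal.Quotient.mk_surjective b
  exact ⟨F, h, rfl⟩

namespace Represents

variable {F G : JetFun p q} {b c : ApproxAlgebra Ω k}

theorem isDiffFun (hF : Represents F b) : IsDiffFun Ω F := hF.1

theorem zero : Represents (fun _ => 0) (0 : ApproxAlgebra Ω k) :=
  ⟨.const 0, rfl⟩

theorem one : Represents (fun _ => 1) (1 : ApproxAlgebra Ω k) :=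
  ⟨.const 1, rfl⟩

theorem add (hF : Represents F b) (hG : Represents G c) :
    Represents (fun z => F z + G z) (b + c) := by
  obtain ⟨hF, rfl⟩ := hF
  obtain ⟨hG, rfl⟩ := hG
  exact ⟨hF.add hG, map_add (toApprox Ω k) ⟨F, hF⟩ ⟨G, hG⟩⟩

theorem mul (hF : Represents F b) (hG : Represents G c) :
    Represents (fun z => F z * G z) (b * c) := by
  obtain ⟨hF, rfl⟩ := hF
  obtain ⟨hG, rfl⟩ := hG
  exact ⟨hF.mul hG, map_mul (toApprox Ω k) ⟨F, hF⟩ ⟨G, hG⟩⟩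

theorem const_mul (hF : Represents F b) (r : ℝ) : Represents (fun z => r * F z) (r • b) := by
  obtain ⟨hF, rfl⟩ := hF
  exact ⟨(diffAlgebra Ω).smul_mem hF r, map_smul (toApprox Ω k) r ⟨F, hF⟩⟩

theorem neg (hF : Represents F b) : Represents (fun z => -F z) (-b) := by
  obtain ⟨hF, rfl⟩ := hF
  exact ⟨(diffAlgebra Ω).neg_mem hF, map_neg (toApprox Ω k) ⟨F, hF⟩⟩

theorem sub (hF : Represents F b) (hG : Represents G c) :
    Represents (fun z => F z - G z) (b - c) := by
  simpa only [sub_eq_add_neg] using hF.add hG.neg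

theorem sum {ι : Type*} {S : Finset ι} {F : ι → JetFun p q} {b : ι → ApproxAlgebra Ω k}
    (h : ∀ i ∈ S, Represents (F i) (b i)) :
    Represents (fun z => ∑ i ∈ S, F i z) (∑ i ∈ S, b i) := by
  classical
  induction S using Finset.induction_on with
  | empty => simpa using zero
  | insert i S hi ih =>
    simp only [Finset.sum_insert hi]
    exact (h i (by simp)).add (ih fun j hj => h j (by simp [hj]))

theorem eq_zero_iff (hF : Represents F b) : b = 0 ↔ IsLittleO Ω k F := by
  obtain ⟨hF, rfl⟩ := hF
  exact Ideal.Quotient.eq_zero_iff_mem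

theorem eq_of_eqOn (hF : Represents F b) (hG : Represents G c) (h : Set.EqOn F G Ω.carrier) :
    b = c := by
  rw [← sub_eq_zero, (hF.sub hG).eq_zero_iff]
  exact isLittleO_of_eq_zero fun z hz => sub_eq_zero.2 (h hz)

theorem congr (hF : Represents F b) (h : Set.EqOn G F Ω.carrier) : Represents G b := by
  obtain ⟨c, hc⟩ := (hF.isDiffFun.congr h).exists_represents k
  rwa [← hc.eq_of_eqOn hF h]

theorem finsum {ι : Type*} {F : ι → JetFun p q} {b : ι → ApproxAlgebra Ω k}
    (h : ∀ i, Represents (F i) (b i)) (hF : {i | ∃ z ∈ Ω.carrier, F i z ≠ 0}.Finite) :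
    Represents (fun z => ∑ᶠ i, F i z) (∑ᶠ i, b i) := by
  have hzero (i) (hi : i ∉ hF.toFinset) : Set.EqOn (F i) (fun _ => 0) Ω.carrier := fun z hz => by
    by_contra hne
    exact hi (hF.mem_toFinset.2 ⟨z, hz, hne⟩)
  rw [finsum_eq_sum_of_support_subset b (s := hF.toFinset) fun i hi => ?_]
  · refine (sum fun i _ => h i).congr fun z hz => ?_
    exact finsum_eq_sum_of_support_subset _ fun i hi => hF.mem_toFinset.2 ⟨z, hz, hi⟩
  · by_contra hiF
    exact hi ((h i).eq_of_eqOn zero (hzero i hiF))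

theorem eq_of_pd {e : Coord p q} (he : e ≠ .eps) {b' c' : ApproxAlgebra Ω k}
    (hF : Represents F b) (hG : Represents G b) (hF' : Represents (pd e F) b')
    (hG' : Represents (pd e G) c') : b' = c' := by
  have hFG := hF.sub hG
  have hpd : IsLittleO Ω k (pd e fun z => F z - G z) :=
    (hFG.eq_zero_iff.1 (sub_self b)).pd hFG.isDiffFun he
  obtain ⟨a, ha⟩ := (hFG.isDiffFun.pd e).exists_represents k
  rw [← sub_eq_zero, ← ha.eq_zero_iff.2 hpd]
  refine (hF'.sub hG').eq_of_eqOn ha fun z hz => ?_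
  exact ((hF.isDiffFun.hasDerivAt e hz).sub (hG.isDiffFun.hasDerivAt e hz)).deriv.symm

end Represents

/-- A differential function that represents the class `b`. -/
def representative (b : ApproxAlgebra Ω k) : JetFun p q := (exists_represents b).choose

theorem represents_representative (b : ApproxAlgebra Ω k) : Represents (representative b) b :=
  (exists_represents b).choose_spec

/-- The class of `∂F/∂e`, where `F` represents `b`. It is independent of `F` unless `e` is `ε`. -/
def approxPd (e : Coord p q) (b : ApproxAlgebra Ω k) : ApproxAlgebra Ω k :=
  toApprox Ω k ⟨pd e (representative b), (represents_representative b).isDiffFun.pd e⟩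

theorem Represents.approxPd {F : JetFun p q} {b : ApproxAlgebra Ω k} {e : Coord p q}
    (he : e ≠ .eps) (hF : Represents F b) : Represents (pd e F) (approxPd e b) :=
  ⟨hF.isDiffFun.pd e, hF.eq_of_pd he (represents_representative b) ⟨_, rfl⟩ ⟨_, rfl⟩⟩

/-- The partial derivative with respect to `e` on classes of differential functions. The value `0`
at `ε` is arbitrary: `∂/∂ε` does not preserve `o(ε^k)`. -/
def pdDerivation (Ω : Domain p q) (k : ℕ) (e : Coord p q) :
    Derivation ℝ (ApproxAlgebra Ω k) (ApproxAlgebra Ω k) :=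
  if he : e = .eps then 0 else
  Derivation.mk'
    { toFun := approxPd e
      map_add' := fun b c => by
        have hb := represents_representative b
        have hc := represents_representative c
        exact ((hb.add hc).approxPd he).eq_of_eqOn ((hb.approxPd he).add (hc.approxPd he))
          fun z hz => pd_add hb.isDiffFun hc.isDiffFun e hz
      map_smul' := fun r b => by
        have hb := represents_representative b
        exact ((hb.const_mul r).approxPd he).eq_of_eqOn ((hb.approxPd he).const_mul r)
          fun z hz => ((hb.isDiffFun.hasDerivAt e hz).const_mul r).deriv }
    fun b c => by
      have hb := represents_representative b
      have hc := represents_representative c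
      exact ((hb.mul hc).approxPd he).eq_of_eqOn
        ((hb.mul (hc.approxPd he)).add (hc.mul (hb.approxPd he)))
        fun z hz => pd_mul hb.isDiffFun hc.isDiffFun e hz

theorem Represents.pdDerivation {F : JetFun p q} {b : ApproxAlgebra Ω k} {e : Coord p q}
    (he : e ≠ .eps) (hF : Represents F b) : Represents (pd e F) (pdDerivation Ω k e b) := by
  rw [PerturbedHamiltonian.pdDerivation, dif_neg he]
  exact hF.approxPd he

theorem pdDerivation_eps : pdDerivation Ω k .eps = 0 := dif_pos rfl

/-- The jet algebra of differential functions modulo `o(ε^k)`. -/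
def jetAlgebra (Ω : Domain p q) (k : ℕ) : JetAlgebra p q (ApproxAlgebra Ω k) where
  d := pdDerivation Ω k
  coord c := toApprox Ω k ⟨fun z => z c, .coord c⟩
  d_coord c e hc := by
    refine (Represents.pdDerivation hc ⟨.coord e, rfl⟩).eq_of_eqOn
      (G := fun _ => if c = e then 1 else 0) ?_ fun z _ => pd_coord c e z
    split_ifs
    exacts [.one, .zero]
  d_comm c e f := by
    obtain rfl | hc := eq_or_ne c .eps
    · simp [pdDerivation_eps]
    obtain rfl | he := eq_or_ne e .eps
    · simp [pdDerivation_eps]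
    have hf := represents_representative f
    exact ((hf.pdDerivation he).pdDerivation hc).eq_of_eqOn
      ((hf.pdDerivation hc).pdDerivation he) fun z hz => pd_comm hf.isDiffFun c e hz
  finite_support f := by
    have hf := represents_representative f
    refine hf.isDiffFun.finite_support.subset fun c hc => ?_
    have hcε : c ≠ .eps := by
      rintro rfl
      simp [pdDerivation_eps] at hc
    by_contra! h
    exact hc ((hf.pdDerivation hcε).eq_of_eqOn .zero fun z hz =>
      by_contra fun hne => h ⟨z, hz, hne⟩)

/-- The ideal of the classes of differential functions that vanish at the time `t₀`. -/
def initialIdeal (k : ℕ) {t₀ : ℝ} (ht₀ : t₀ ∈ Ω.T) : (jetAlgebra Ω k).InitialIdeal where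
  ideal :=
    { carrier := {b | ∃ F, Represents F b ∧ ∀ z ∈ Ω.carrier, z .time = t₀ → F z = 0}
      zero_mem' := ⟨_, .zero, fun _ _ _ => rfl⟩
      add_mem' := by
        rintro b c ⟨F, hF, hF0⟩ ⟨G, hG, hG0⟩
        exact ⟨_, hF.add hG, fun z hz h => by simp [hF0 z hz h, hG0 z hz h]⟩
      smul_mem' := by
        rintro b c ⟨G, hG, hG0⟩
        exact ⟨_, (represents_representative b).mul hG, fun z hz h => by simp [hG0 z hz h]⟩ }
  d_mem := by
    rintro c f hc ⟨F, hF, hF0⟩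
    obtain rfl | he := eq_or_ne c .eps
    · rw [show (jetAlgebra Ω k).d .eps f = 0 from DFunLike.congr_fun pdDerivation_eps f]
      exact zero_mem _
    · exact ⟨_, hF.pdDerivation he, fun z hz h => pd_eq_zero_of_slice hc hF0 hz h⟩
  eq_zero_of_d_time_eq_zero := by
    rintro f ⟨F, hF, hF0⟩ h
    exact hF.eq_zero_iff.2 <| isLittleO_of_pd_time hF.isDiffFun ht₀ hF0 <|
      (hF.pdDerivation (by simp)).eq_zero_iff.1 h
  exists_primitive f := by
    have hf := represents_representative f
    obtain ⟨g, hg⟩ := (hf.isDiffFun.primitive ht₀).exists_represents k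
    exact ⟨g, ⟨_, hg, fun z _ h => primitive_eq_zero _ _ h⟩,
      (hg.pdDerivation (by simp)).eq_of_eqOn hf fun z hz => pd_time_primitive hf.isDiffFun ht₀ hz⟩

/-! ### Transport of the operations of the jet algebra -/

theorem totalD_eq_zero {F : JetFun p q} (h : ∀ z ∈ Ω.carrier, F z = 0) (i : Fin p) :
    ∀ z ∈ Ω.carrier, totalD i F z = 0 := by
  intro z hz
  simp only [totalD, pd_congr (G := fun _ => 0) h _ z hz, pd_const, mul_zero, finsum_zero,
    Finset.sum_const_zero, add_zero]

theorem totalDJ_eq_zero {F : JetFun p q} (h : ∀ z ∈ Ω.carrier, F z = 0) (J : MultiIndex p) :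
    ∀ z ∈ Ω.carrier, totalDJ J F z = 0 := by
  rw [totalDJ]
  induction List.finRange p with
  | nil => exact h
  | cons i l ih =>
    exact Function.Iterate.rec (fun G : JetFun p q => ∀ z ∈ Ω.carrier, G z = 0)
      (app := fun _ hG => totalD_eq_zero hG i) (arg := ih) (J i)

namespace Represents

variable {F G : JetFun p q} {b c : ApproxAlgebra Ω k}
  {Q : Fin q → JetFun p q} {Q' : Fin q → ApproxAlgebra Ω k}

theorem dj (hF : Represents F b) (α : Fin q) (J : MultiIndex p) :
    Represents (pd (.jet α J) F) ((jetAlgebra Ω k).dj (α, J) b) :=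
  hF.pdDerivation (by simp)

theorem vert (hF : Represents F b) {a : Fin q × MultiIndex p → JetFun p q}
    {a' : Fin q × MultiIndex p → ApproxAlgebra Ω k} (ha : ∀ s, Represents (a s) (a' s)) :
    Represents (fun z => ∑ α : Fin q, ∑ᶠ J : MultiIndex p, a (α, J) z * pd (.jet α J) F z)
      ((jetAlgebra Ω k).vert a' b) := by
  rw [JetAlgebra.vert_eq_sum_finsum]
  refine sum fun α _ => finsum (fun J => (ha (α, J)).mul (hF.dj α J)) ?_
  exact (hF.isDiffFun.finite_support_jet α).subset fun J ⟨z, hz, hne⟩ =>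
    ⟨z, hz, right_ne_zero_of_mul hne⟩

protected theorem totalD (hF : Represents F b) (i : Fin p) :
    Represents (totalD i F) ((jetAlgebra Ω k).D i b) :=
  (hF.pdDerivation (by simp)).add <|
    hF.vert fun s => ⟨.coord (.jet s.1 (s.2 + Pi.single i 1)), rfl⟩

protected theorem totalDJ (hF : Represents F b) (J : MultiIndex p) :
    Represents (totalDJ J F) ((jetAlgebra Ω k).DJ J b) := by
  rw [totalDJ, JetAlgebra.DJ]
  induction List.finRange p with
  | nil => exact hF
  | cons i l ih =>
    rw [List.foldr_cons, List.map_cons, List.prod_cons, Module.End.mul_apply]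
    induction J i with
    | zero => exact ih
    | succ n ihn =>
      rw [Function.iterate_succ_apply', pow_succ', Module.End.mul_apply]
      exact ihn.totalD i

protected theorem prEvol (hQ : ∀ α, Represents (Q α) (Q' α)) (hF : Represents F b) :
    Represents (prEvol Q F) ((jetAlgebra Ω k).pr Q' b) :=
  hF.vert fun s => (hQ s.1).totalDJ s.2

protected theorem totalDt (hQ : ∀ α, Represents (Q α) (Q' α)) (hF : Represents F b) :
    Represents (totalDt Q F) ((jetAlgebra Ω k).Dt Q' b) :=
  (hF.pdDerivation (by simp)).add (hF.prEvol hQ)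

protected theorem totalDiv {X : Fin p → JetFun p q} {X' : Fin p → ApproxAlgebra Ω k}
    (hX : ∀ i, Represents (X i) (X' i)) :
    Represents (totalDiv X) (∑ i, (jetAlgebra Ω k).D i (X' i)) :=
  sum fun i _ => (hX i).totalD i

protected theorem euler (hF : Represents F b) (α : Fin q) :
    Represents (euler F α) ((jetAlgebra Ω k).euler b α) := by
  refine finsum (fun J => ((hF.dj α J).totalDJ J).const_mul _) ?_
  refine (hF.isDiffFun.finite_support_jet α).subset fun J ⟨z, hz, hne⟩ => ?_
  by_contra! h
  refine right_ne_zero_of_mul hne (totalDJ_eq_zero (fun y hy => ?_) J z hz)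
  exact by_contra fun hy' => h ⟨y, hy, hy'⟩

end Represents

/-! ### Matrix differential operators -/

/-- The action of a matrix differential operator on classes of differential functions. -/
def operator (k : ℕ) {𝒟 : MatDiffOp p q} (h𝒟 : IsMatDiffOp Ω 𝒟) :
    (Fin q → ApproxAlgebra Ω k) →+ (Fin q → ApproxAlgebra Ω k) where
  toFun Q α := ∑ β, ∑ J ∈ (𝒟 α β).support,
    toApprox Ω k ⟨𝒟 α β J, (h𝒟 α β J).1⟩ * (jetAlgebra Ω k).DJ J (Q β)
  map_zero' := by
    ext α
    simp
  map_add' Q R := by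
    ext α
    simp [mul_add, Finset.sum_add_distrib]

section operator

variable {𝒟 : MatDiffOp p q} (h𝒟 : IsMatDiffOp Ω 𝒟)

theorem operator_apply (Q : Fin q → ApproxAlgebra Ω k) (α : Fin q) :
    operator k h𝒟 Q α = ∑ β, ∑ J ∈ (𝒟 α β).support,
      toApprox Ω k ⟨𝒟 α β J, (h𝒟 α β J).1⟩ * (jetAlgebra Ω k).DJ J (Q β) :=
  rfl

theorem pd_time_of_isAutonomous {F : JetFun p q} (hF : IsAutonomous Ω F) :
    ∀ z ∈ Ω.carrier, pd .time F z = 0 := by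
  intro z hz
  have hconst : (fun s => F (Function.update z .time s)) =ᶠ[𝓝 (z .time)] fun _ => F z := by
    filter_upwards [Ω.isOpen_T.mem_nhds hz.1] with s hs using hF z hz s hs
  rw [pd, hconst.deriv_eq, deriv_const]

theorem d_time_operator (Q : Fin q → ApproxAlgebra Ω k) (α : Fin q) :
    (jetAlgebra Ω k).d .time (operator k h𝒟 Q α) =
      operator k h𝒟 (fun β => (jetAlgebra Ω k).d .time (Q β)) α := by
  have hcoeff (β J) : (jetAlgebra Ω k).d .time (toApprox Ω k ⟨𝒟 α β J, (h𝒟 α β J).1⟩) = 0 :=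
    (Represents.pdDerivation (by simp) ⟨_, rfl⟩).eq_of_eqOn .zero
      (pd_time_of_isAutonomous (h𝒟 α β J).2)
  have hDJ (J f) : (jetAlgebra Ω k).d .time ((jetAlgebra Ω k).DJ J f) =
      (jetAlgebra Ω k).DJ J ((jetAlgebra Ω k).d .time f) :=
    (jetAlgebra Ω k).DJ_commute (φ := ((jetAlgebra Ω k).d .time : Module.End ℝ _))
      (jetAlgebra Ω k).d_time_D J f
  simp only [operator_apply, map_sum, Derivation.leibniz, hcoeff, hDJ, smul_eq_mul,
    mul_zero, add_zero]

theorem operator_mem_ideal (I : (jetAlgebra Ω k).InitialIdeal) {Q : Fin q → ApproxAlgebra Ω k}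
    (hQ : ∀ β, Q β ∈ I.ideal) (α : Fin q) : operator k h𝒟 Q α ∈ I.ideal := by
  rw [operator_apply]
  exact sum_mem fun β _ => sum_mem fun J _ => I.ideal.mul_mem_left _ (I.DJ_mem J (hQ β))

namespace Represents

variable {F G : JetFun p q} {b c : ApproxAlgebra Ω k}

theorem apply {Q : Fin q → JetFun p q} {Q' : Fin q → ApproxAlgebra Ω k}
    (hQ : ∀ α, Represents (Q α) (Q' α)) (α : Fin q) :
    Represents (𝒟.apply Q α) (operator k h𝒟 Q' α) :=
  sum fun β _ => sum fun J _ => mul ⟨_, rfl⟩ ((hQ β).totalDJ J)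

theorem apply_euler (hF : Represents F b) (α : Fin q) :
    Represents (𝒟.apply (PerturbedHamiltonian.euler F) α)
      (operator k h𝒟 ((jetAlgebra Ω k).euler b) α) :=
  apply h𝒟 hF.euler α

protected theorem bracket (hF : Represents F b) (hG : Represents G c) :
    Represents (bracket 𝒟 F G) ((jetAlgebra Ω k).bracket (operator k h𝒟) b c) :=
  sum fun α _ => (hF.euler α).mul (hG.apply_euler h𝒟 α)

end Represents

end operator

/-! ### The approximate notions in terms of classes -/

section classes

variable {F G : JetFun p q} {b c : ApproxAlgebra Ω k} {K Q : Fin q → JetFun p q}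
  {K' Q' : Fin q → ApproxAlgebra Ω k}

theorem Represents.mem_divRange_iff (hF : Represents F b) :
    b ∈ (jetAlgebra Ω k).divRange ↔
      ∃ X, (∀ i, IsDiffFun Ω (X i)) ∧ IsLittleO Ω k fun z => F z - totalDiv X z := by
  rw [JetAlgebra.mem_divRange_iff]
  constructor
  · rintro ⟨X', rfl⟩
    choose X hX using fun i => exists_represents (X' i)
    exact ⟨X, fun i => (hX i).isDiffFun,
      (hF.sub (Represents.totalDiv hX)).eq_zero_iff.1 (sub_self _)⟩
  · rintro ⟨X, hX, h⟩
    choose X' hX' using fun i => (hX i).exists_represents k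
    exact ⟨X', (sub_eq_zero.1 ((hF.sub (Represents.totalDiv hX')).eq_zero_iff.2 h)).symm⟩

theorem functionalApprox_iff (hF : Represents F b) (hG : Represents G c) :
    FunctionalApprox Ω k F G ↔ b ≡ c [SMOD (jetAlgebra Ω k).divRange] := by
  rw [SModEq.sub_mem, (hF.sub hG).mem_divRange_iff, FunctionalApprox]

theorem isApproxConservationLaw_iff (hK : ∀ α, Represents (K α) (K' α)) (hF : Represents F b) :
    IsApproxConservationLaw Ω k K F ↔
      (jetAlgebra Ω k).Dt K' b ≡ 0 [SMOD (jetAlgebra Ω k).divRange] := by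
  have hneg (X : Fin p → JetFun p q) :
      IsLittleO Ω k (fun z => -totalDt K F z - totalDiv X z) ↔
        IsLittleO Ω k fun z => totalDt K F z + totalDiv X z := by
    simp only [IsLittleO, ← neg_add', Asymptotics.isLittleO_neg_left]
  rw [SModEq.zero, ← neg_mem_iff, (Represents.totalDt hK hF).neg.mem_divRange_iff]
  simp only [hneg, IsApproxConservationLaw]

theorem isApproxSymmetry_iff (hK : ∀ α, Represents (K α) (K' α))
    (hQ : ∀ α, Represents (Q α) (Q' α)) :
    IsApproxSymmetry Ω k K Q ↔
      ∀ ν, (jetAlgebra Ω k).Dt K' (Q' ν) - (jetAlgebra Ω k).pr Q' (K' ν) = 0 :=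
  forall_congr' fun ν =>
    (((hQ ν).totalDt hK).sub (Represents.prEvol hQ (hK ν))).eq_zero_iff.symm

theorem isApproxDistinguished_iff {𝒟 : MatDiffOp p q} (h𝒟 : IsMatDiffOp Ω 𝒟)
    (hG : Represents G c) :
    IsApproxDistinguished Ω k 𝒟 G ↔ operator k h𝒟 ((jetAlgebra Ω k).euler c) = 0 := by
  simp only [funext_iff, Pi.zero_apply, (hG.apply_euler h𝒟 _).eq_zero_iff, IsApproxDistinguished]

theorem IsApproxHamiltonianOp.isHamiltonian {𝒟 : MatDiffOp p q}
    (h𝒟 : IsApproxHamiltonianOp Ω k 𝒟) :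
    (jetAlgebra Ω k).IsHamiltonian (operator k h𝒟.isMatDiffOp) where
  skew P L := by
    obtain ⟨_, hP⟩ := exists_represents P
    obtain ⟨_, hL⟩ := exists_represents L
    exact (functionalApprox_iff (hP.bracket h𝒟.isMatDiffOp hL) (hL.bracket h𝒟.isMatDiffOp hP).neg).1
      (h𝒟.skew _ _ hP.isDiffFun hL.isDiffFun)
  jacobi P L R := by
    obtain ⟨_, hP⟩ := exists_represents P
    obtain ⟨_, hL⟩ := exists_represents L
    obtain ⟨_, hR⟩ := exists_represents R
    have hbracket {F G b c} (hF : Represents F b) (hG : Represents G c) :=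
      hF.bracket (k := k) h𝒟.isMatDiffOp hG
    exact (functionalApprox_iff (((hbracket (hbracket hP hL) hR).add
      (hbracket (hbracket hL hR) hP)).add (hbracket (hbracket hR hP) hL)) .zero).1
      (h𝒟.jacobi _ _ _ hP.isDiffFun hL.isDiffFun hR.isDiffFun)

end classes

end approxAlgebra

end PerturbedHamiltonian

end

theorem mainTheorem3_general {p q : ℕ} (Ω : PerturbedHamiltonian.Domain p q) (k : ℕ)
    (𝒟 : PerturbedHamiltonian.MatDiffOp p q)
    (h𝒟 : PerturbedHamiltonian.IsApproxHamiltonianOp Ω k 𝒟)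
    (H : PerturbedHamiltonian.JetFun p q)
    (hH : PerturbedHamiltonian.IsDiffFun Ω H)
    (P : PerturbedHamiltonian.JetFun p q)
    (hP : PerturbedHamiltonian.IsDiffFun Ω P) :
    PerturbedHamiltonian.IsApproxSymmetry Ω k
        (𝒟.apply (PerturbedHamiltonian.euler H)) (𝒟.apply (PerturbedHamiltonian.euler P)) ↔
      ∃ G P' : PerturbedHamiltonian.JetFun p q,
        PerturbedHamiltonian.IsDiffFun Ω G ∧
        PerturbedHamiltonian.IsDiffFun Ω P' ∧
        PerturbedHamiltonian.IsApproxDistinguished Ω k 𝒟 G ∧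
        PerturbedHamiltonian.FunctionalApprox Ω k P' (fun z => P z - G z) ∧
        PerturbedHamiltonian.IsApproxConservationLaw Ω k
          (𝒟.apply (PerturbedHamiltonian.euler H)) P' := by
  open PerturbedHamiltonian in
  obtain ⟨t₀, ht₀⟩ := Ω.isConnected_T.nonempty
  obtain ⟨h, hh⟩ := hH.exists_represents k
  obtain ⟨b, hb⟩ := hP.exists_represents k
  have hM := h𝒟.isMatDiffOp
  rw [isApproxSymmetry_iff (hh.apply_euler hM) (hb.apply_euler hM),
    h𝒟.isHamiltonian.noether (initialIdeal k ht₀) (d_time_operator hM)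
      (fun _ hQ => operator_mem_ideal hM _ hQ) h b]
  constructor
  · rintro ⟨g, c, hg, hc, hlaw⟩
    obtain ⟨G, hG⟩ := exists_represents g
    obtain ⟨P', hP'⟩ := exists_represents c
    exact ⟨G, P', hG.isDiffFun, hP'.isDiffFun, (isApproxDistinguished_iff hM hG).2 hg,
      (functionalApprox_iff hP' (hb.sub hG)).2 hc,
      (isApproxConservationLaw_iff (hh.apply_euler hM) hP').2 hlaw⟩
  · rintro ⟨G, P', hG, hP', hdist, happrox, hlaw⟩
    obtain ⟨g, hg⟩ := hG.exists_represents k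
    obtain ⟨c, hc⟩ := hP'.exists_represents k
    exact ⟨g, c, (isApproxDistinguished_iff hM hg).1 hdist,
      (functionalApprox_iff hc (hb.sub hg)).1 happrox,
      (isApproxConservationLaw_iff (hh.apply_euler hM) hc).1 hlaw⟩

theorem mainTheorem3 {p q : ℕ} (Ω : PerturbedHamiltonian.Domain p q) (k : ℕ)
    (𝒟 : PerturbedHamiltonian.MatDiffOp p q)
    (h𝒟 : PerturbedHamiltonian.IsApproxHamiltonianOp Ω k 𝒟)
    (H : PerturbedHamiltonian.JetFun p q)
    (hH : PerturbedHamiltonian.IsDiffFun Ω H)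
    (hHt : PerturbedHamiltonian.IsAutonomous Ω H)
    (P : PerturbedHamiltonian.JetFun p q)
    (hP : PerturbedHamiltonian.IsDiffFun Ω P) :
    PerturbedHamiltonian.IsApproxSymmetry Ω k
        (𝒟.apply (PerturbedHamiltonian.euler H)) (𝒟.apply (PerturbedHamiltonian.euler P)) ↔
      ∃ G P' : PerturbedHamiltonian.JetFun p q,
        PerturbedHamiltonian.IsDiffFun Ω G ∧
        PerturbedHamiltonian.IsDiffFun Ω P' ∧
        PerturbedHamiltonian.IsApproxDistinguished Ω k 𝒟 G ∧
        PerturbedHamiltonian.FunctionalApprox Ω k P' (fun z => P z - G z) ∧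
        PerturbedHamiltonian.IsApproxConservationLaw Ω k
          (𝒟.apply (PerturbedHamiltonian.euler H)) P' :=
  mainTheorem3_general Ω k 𝒟 h𝒟 H hH P hP
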